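/- \textbf{Setting.} Let $\mathcal H=\bigotimes_{i=1}^N\mathcal H_i$ with $\mathcal H_i\simeq\mathbb C^{d_i}$, let $\mathcal N=(\mathcal N_1,\dots,\mathcal N_K)$ be a list of subsets (neighborhoods) of $\{1,\dots,N\}$, let $|\psi\rangle\in\mathcal H$ be a unit vector and $\rho=|\psi\rangle\langle\psi|$. For a set $S$ of sites put $\mathcal H_S=\bigotimes_{i\in S}\mathcal H_i$ and let $\overline S$ be its complement. A \emph{neighborhood map} is a CPTP map of the form $\mathcal F\otimes\mathrm{id}_{\overline{\mathcal N}_k}$ for some $k$, with $\mathcal F$ a CPTP map on $\mathcal B(\mathcal H_{\mathcal N_k})$. $\bullet$ $|\psi\rangle$ is \emph{QLS} if there is a sequence $(\mathcal E_t)_{t\ge 0}$ of neighborhood maps with $\mathcal E_t(\rho)=\rho$ for all $t$ and $\lim_{t\to\infty}\mathcal E_{t-1}\circ\dots\circ\mathcal E_s(\sigma)=\rho$ for every density operator $\sigma$ and every $s\ge 0$. $\bullet$ $|\psi\rangle$ is \emph{RFTS} if there is a finite sequence $\mathcal E_1,\dots,\mathcal E_T$ of neighborhood maps with $\mathcal E_t(\rho)=\rho$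 for all $t$, such that $T$ is the smallest integer with $\mathcal E_T\circ\dots\circ\mathcal E_1(\sigma)=\rho$ for all density operators $\sigma$, and such that $\mathcal E_{\pi(T)}\circ\dots\circ\mathcal E_{\pi(1)}(\sigma)=\rho$ for all density operators $\sigma$ and every permutation $\pi$. $\bullet$ $\Pi_k=\Pi_{\mathcal N_k}\otimes\mathbb I_{\overline{\mathcal N}_k}$, where $\Pi_{\mathcal N_k}$ is the orthogonal projector onto the Schmidt span of $|\psi\rangle$ in $\mathcal H_{\mathcal N_k}$ (the span of the left vectors of a Schmidt decomposition of $|\psi\rangle$ in $\mathcal H_{\mathcal N_k}\otimes\mathcal H_{\overline{\mathcal N}_k}$). $\bullet$ Let $\tilde{\mathcal H}_i=\operatorname{supp}(\operatorname{tr}_{\overline i}\rho)$, $\tilde{\mathcal H}_S=\bigotimes_{i\in S}\tilde{\mathcal H}_i$, and let $\tilde{\mathcal H}=\bigotimes_{i=1}^N\tilde{\mathcal H}_i$ be the local support space of $\rho$, with $\mathcal H=\mathcal H^0\oplus\tilde{\mathcal H}$, $\mathcal H^0=\tilde{\mathcal H}^\perp$. $\bullet$ The \emph{neighborhood algebra}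 $\mathcal A_j$ is the set of all $(c\,\mathbb I\oplus X)\otimes\mathbb I_{\overline{\mathcal N}_j}$, relative to $\mathcal H_{\mathcal N_j}=(\tilde{\mathcal H}_{\mathcal N_j})^\perp\oplus\tilde{\mathcal H}_{\mathcal N_j}$, with $c\in\mathbb C$ and $X\in\mathcal B(\tilde{\mathcal H}_{\mathcal N_j})$ such that $X\otimes\mathbb I_{\tilde{\mathcal H}_{\overline{\mathcal N}_j}}$ commutes on $\tilde{\mathcal H}$ with $\Pi_k|_{\tilde{\mathcal H}}$ for all $k\neq j$. \textbf{Theorem (Algebraic factorization RFTS).} Let $|\psi\rangle$ be QLS with respect to $\mathcal N$, and let the restrictions $\mathcal A_j|_{\tilde{\mathcal H}}$ be commuting (elements of $\mathcal A_j|_{\tilde{\mathcal H}}$ and $\mathcal A_k|_{\tilde{\mathcal H}}$ commute for $j\ne k$) and complete (their union generates $\mathcal B(\tilde{\mathcal H})$). Then: (1) There are finite-dimensional Hilbert spaces $\hat{\mathcal H}_1,\dots,\hat{\mathcal H}_K$ and a unitary $W:\tilde{\mathcal H}\to\bigotimes_{j=1}^K\hat{\mathcal H}_j$ that is induced by the neighborhood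 algebras, i.e. $W\,\mathcal A_j|_{\tilde{\mathcal H}}\,W^{-1}=\mathcal B(\hat{\mathcal H}_j)\otimes\mathbb I_{\overline j}$ for every $j$. (2) For every such induced factorization there are unit vectors $|\hat\psi_j\rangle\in\hat{\mathcal H}_j$ with $|\psi\rangle=0\oplus W^{-1}\bigotimes_{j}|\hat\psi_j\rangle\in\mathcal H^0\oplus\tilde{\mathcal H}$. (3) $|\psi\rangle$ is RFTS with respect to $\mathcal N$. -/

import Mathlib

open Filter Topology
open scoped Matrix Kronecker ComplexOrder

noncomputable section

namespace QuasiLocal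

/-! ### Vectors, operators, states -/

/-- The finite-dimensional Hilbert space with orthonormal basis indexed by `n`. -/
abbrev Hilb (n : Type) : Type := EuclideanSpace ℂ n

/-- The operators on `Hilb n`, as matrices in the standard basis. -/
abbrev Op (n : Type) : Type := Matrix n n ℂ

/-- The action of an operator on vectors. -/
abbrev act {n : Type} [Fintype n] [DecidableEq n] (X : Op n) : Hilb n →ₗ[ℂ] Hilb n :=
  Matrix.toEuclideanLin X

/-- Density operators. -/
def IsDensity {n : Type} [Fintype n] (ρ : Op n) : Prop :=
  ρ.PosSemidef ∧ ρ.trace = 1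

/-- The operator `|ψ⟩⟨ψ|`. -/
def ketbra {n : Type} (ψ : Hilb n) : Op n :=
  Matrix.of fun a b => ψ a * star (ψ b)

/-- The orthogonal projector onto a subspace, as a matrix. -/
def proj {n : Type} [Fintype n] [DecidableEq n] (K : Submodule ℂ (Hilb n)) : Op n :=
  Matrix.toEuclideanLin.symm (K.starProjection : Hilb n →ₗ[ℂ] Hilb n)

/-- Completely positive trace-preserving maps (in Kraus form). -/
def IsCPTP {n : Type} [Fintype n] [DecidableEq n] (F : Op n →ₗ[ℂ] Op n) : Prop :=
  ∃ (r : ℕ) (Kr : Fin r → Op n),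
    ∑ a, (Kr a)ᴴ * Kr a = 1 ∧ ∀ M, F M = ∑ a, Kr a * M * (Kr a)ᴴ

/-! ### Bipartite systems

A bipartition `Hilb C ≃ Hilb A ⊗ Hilb B` is given by a bijection `e : C ≃ A × B` of the standard
(product) basis. -/

/-- The operator `X ⊗ 𝕀`. -/
def ampliate {A B C : Type} [DecidableEq B] (e : C ≃ A × B) (X : Op A) : Op C :=
  (X ⊗ₖ (1 : Op B)).submatrix e e

/-- The partial trace over the second factor. -/
def partialTrace {A B C : Type} [Fintype B] (e : C ≃ A × B) (M : Op C) : Op A :=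
  Matrix.of fun a a' => ∑ b, M (e.symm (a, b)) (e.symm (a', b))

/-- `E = F ⊗ id`, as maps on operators. -/
def IsTensorId {A B C : Type} (e : C ≃ A × B) (E : Op C →ₗ[ℂ] Op C) (F : Op A →ₗ[ℂ] Op A) :
    Prop :=
  ∀ (M : Op C) (a a' : A) (b b' : B), E M (e.symm (a, b)) (e.symm (a', b')) =
    F (Matrix.of fun x x' => M (e.symm (x, b)) (e.symm (x', b'))) a a'

/-- The vector `(𝕀 ⊗ ⟨b|) ψ` of the first factor. -/
def slice {A B C : Type} (e : C ≃ A × B) (ψ : Hilb C) (b : B) : Hilb A :=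
  WithLp.toLp 2 fun a => ψ (e.symm (a, b))

/-- The Schmidt span of `ψ` with respect to the first factor, i.e. the column space of its
coefficient matrix. `schmidtSpan_eq` below identifies it with the span of the left
vectors of any Schmidt decomposition of `ψ`. -/
def schmidtSpan {A B C : Type} (e : C ≃ A × B) (ψ : Hilb C) : Submodule ℂ (Hilb A) :=
  Submodule.span ℂ (Set.range (slice e ψ))

theorem schmidtSpan_eq {A B C : Type} [Fintype A] [Fintype B] (e : C ≃ A × B) (ψ : Hilb C)
    {r : ℕ} (s : Fin r → ℝ) (hs : ∀ i, 0 < s i) (u : Fin r → Hilb A) (w : Fin r → Hilb B)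
    (hw : Orthonormal ℂ w)
    (h : ∀ a b, ψ (e.symm (a, b)) = ∑ i, (s i : ℂ) * (u i a * w i b)) :
    schmidtSpan e ψ = Submodule.span ℂ (Set.range u) := by
  apply le_antisymm
  · refine Submodule.span_le.2 ?_
    rintro _ ⟨b, rfl⟩
    have : slice e ψ b = ∑ i, ((s i : ℂ) * w i b) • u i := by
      ext a
      simp only [slice, h, PiLp.toLp_apply, WithLp.ofLp_sum, WithLp.ofLp_smul, Finset.sum_apply, Pi.smul_apply, smul_eq_mul]
      exact Finset.sum_congr rfl fun i _ => by ring
    rw [this]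
    exact Submodule.sum_mem _ fun i _ =>
      Submodule.smul_mem _ _ (Submodule.subset_span ⟨i, rfl⟩)
  · refine Submodule.span_le.2 ?_
    rintro _ ⟨j, rfl⟩
    have hw' : ∀ i, ∑ b, star (w j b) * w i b = if j = i then 1 else 0 := by
      intro i
      have := (orthonormal_iff_ite.1 hw) j i
      simpa [PiLp.inner_apply, mul_comm] using this
    have : u j = ((s j : ℂ)⁻¹) • ∑ b, star (w j b) • slice e ψ b := by
      ext a
      have h1 : ∑ b, star (w j b) * ψ (e.symm (a, b)) = (s j : ℂ) * u j a := by
        calc ∑ b, star (w j b) * ψ (e.symm (a, b))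
            = ∑ i, (s i : ℂ) * u i a * ∑ b, star (w j b) * w i b := by
              simp only [h, Finset.mul_sum]
              rw [Finset.sum_comm]
              refine Finset.sum_congr rfl fun i _ => Finset.sum_congr rfl fun b _ => ?_
              ring
          _ = (s j : ℂ) * u j a := by simp only [hw']; simp
      have h2 : (s j : ℂ) ≠ 0 := by exact_mod_cast (hs j).ne'
      have h3 : u j a = (s j : ℂ)⁻¹ * ∑ b, star (w j b) * ψ (e.symm (a, b)) := by
        rw [h1, inv_mul_cancel_left₀ h2]
      simpa [slice] using h3
    rw [this]
    exact Submodule.smul_mem _ _ (Submodule.sum_mem _ fun b _ =>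
      Submodule.smul_mem _ _ (Submodule.subset_span ⟨b, rfl⟩))

/-! ### Multipartite systems -/

/-- The product basis of `⨂ i, ℂ^(d i)`; the multipartite space itself is `Hilb (Cfg d)`. -/
abbrev Cfg {ι : Type} (d : ι → ℕ) : Type := ∀ i, Fin (d i)

/-- The product vector `⨂ i, v i`. -/
def prodVec {ι : Type} [Fintype ι] {d : ι → ℕ} (v : ∀ i, Hilb (Fin (d i))) : Hilb (Cfg d) :=
  WithLp.toLp 2 fun x => ∏ i, v i (x i)

/-- The subspace `⨂ i, L i` of `⨂ i, ℂ^(d i)`. -/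
def tensorSubspace {ι : Type} [Fintype ι] {d : ι → ℕ}
    (L : ∀ i, Submodule ℂ (Hilb (Fin (d i)))) : Submodule ℂ (Hilb (Cfg d)) :=
  Submodule.span ℂ {w | ∃ v : ∀ i, Hilb (Fin (d i)), (∀ i, v i ∈ L i) ∧ w = prodVec v}

/-- The bipartition of a multipartite system into one factor and all the others. -/
abbrev single {ι : Type} [DecidableEq ι] (d : ι → ℕ) (i : ι) :
    Cfg d ≃ Fin (d i) × Cfg (fun j : {j // j ≠ i} => d j) :=
  Equiv.piSplitAt i fun j => Fin (d j)

/-- The product basis of the subsystem formed by the sites in `S`. -/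
abbrev SubCfg {N : ℕ} (d : Fin N → ℕ) (S : Finset (Fin N)) : Type :=
  Cfg (fun i : {i // i ∈ S} => d i)

/-- The bipartition into the sites in `S` and the sites outside `S`. -/
abbrev split {N : ℕ} (d : Fin N → ℕ) (S : Finset (Fin N)) :
    Cfg d ≃ SubCfg d S × Cfg (fun i : {i // ¬ i ∈ S} => d i) :=
  Equiv.piEquivPiSubtypeProd (· ∈ S) fun i => Fin (d i)

/-! ### Quasi-local dynamics and stabilizability -/

/-- CPTP maps of the form `F ⊗ id`, with `F` acting on the sites in `S`. -/
def IsNeighborhoodMap {N : ℕ} (d : Fin N → ℕ) (S : Finset (Fin N))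
    (E : Op (Cfg d) →ₗ[ℂ] Op (Cfg d)) : Prop :=
  ∃ F : Op (SubCfg d S) →ₗ[ℂ] Op (SubCfg d S), IsCPTP F ∧ IsTensorId (split d S) E F

/-- Apply the maps of a list one after the other, the head of the list first. -/
def applyMaps {n : Type} (L : List (Op n →ₗ[ℂ] Op n)) (σ : Op n) : Op n :=
  L.foldl (fun τ E => E τ) σ

/-- `ρ` is invariant and attractive for the dynamics `E 0, E 1, E 2, …`, from any starting
time `s`. -/
def IsGAS {n : Type} [Fintype n] (ρ : Op n) (E : ℕ → Op n →ₗ[ℂ] Op n) : Prop :=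
  (∀ t, E t ρ = ρ) ∧
  ∀ σ, IsDensity σ → ∀ s : ℕ,
    Tendsto (fun k : ℕ => applyMaps ((List.range k).map fun i => E (s + i)) σ) atTop (𝓝 ρ)

/-- Discrete-time quasi-local stabilizability with respect to the neighborhoods `nbhd k`. -/
def IsQLS {N K : ℕ} (d : Fin N → ℕ) (nbhd : Fin K → Finset (Fin N)) (ρ : Op (Cfg d)) : Prop :=
  ∃ E : ℕ → Op (Cfg d) →ₗ[ℂ] Op (Cfg d),
    (∀ t, ∃ k, IsNeighborhoodMap d (nbhd k) (E t)) ∧ IsGAS ρ E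

/-- The maps of the list, applied in order, take every density operator to `ρ`. -/
def Prepares {n : Type} [Fintype n] (L : List (Op n →ₗ[ℂ] Op n)) (ρ : Op n) : Prop :=
  ∀ σ, IsDensity σ → applyMaps L σ = ρ

/-- The sequence `E 0, …, E (T-1)` of neighborhood maps stabilizes `ρ` in (exactly) `T` steps:
every map leaves `ρ` invariant, and `T` is the smallest number of steps after which the
sequence takes every density operator to `ρ`. -/
def StabilizesIn {N K : ℕ} (d : Fin N → ℕ) (nbhd : Fin K → Finset (Fin N)) (ρ : Op (Cfg d))
    (T : ℕ) (E : Fin T → Op (Cfg d) →ₗ[ℂ] Op (Cfg d)) : Prop :=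
  (∀ t, ∃ k, IsNeighborhoodMap d (nbhd k) (E t)) ∧
  (∀ t, E t ρ = ρ) ∧
  Prepares (List.ofFn E) ρ ∧
  ∀ S < T, ¬ Prepares ((List.ofFn E).take S) ρ

/-- Robust finite-time stabilizability: the maps prepare `ρ` in whatever order they are applied. -/
def IsRFTS {N K : ℕ} (d : Fin N → ℕ) (nbhd : Fin K → Finset (Fin N)) (ρ : Op (Cfg d)) : Prop :=
  ∃ (T : ℕ) (E : Fin T → Op (Cfg d) →ₗ[ℂ] Op (Cfg d)), StabilizesIn d nbhd ρ T E ∧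
    ∀ π : Equiv.Perm (Fin T), Prepares (List.ofFn fun t => E (π t)) ρ

/-! ### Local support and neighborhood algebras -/

/-- The projector `Π_S = Π_{Σ_S(ψ)} ⊗ 𝕀` onto the extended Schmidt span of `ψ` on the sites
in `S`. -/
def schmidtProj {N : ℕ} (d : Fin N → ℕ) (ψ : Hilb (Cfg d)) (S : Finset (Fin N)) : Op (Cfg d) :=
  ampliate (split d S) (proj (schmidtSpan (split d S) ψ))

/-- The support of the reduced state of `|ψ⟩⟨ψ|` at the site `i`. -/
def siteSupport {N : ℕ} (d : Fin N → ℕ) (ψ : Hilb (Cfg d)) (i : Fin N) :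
    Submodule ℂ (Hilb (Fin (d i))) :=
  LinearMap.range (act (partialTrace (single d i) (ketbra ψ)))

/-- The local support of `|ψ⟩⟨ψ|`: the tensor product over all sites of the site supports. -/
def localSupport {N : ℕ} (d : Fin N → ℕ) (ψ : Hilb (Cfg d)) : Submodule ℂ (Hilb (Cfg d)) :=
  tensorSubspace fun i => siteSupport d ψ i

/-- The local support of `|ψ⟩⟨ψ|` on the sites in `S`, inside the space of these sites. -/
def localSupportOn {N : ℕ} (d : Fin N → ℕ) (ψ : Hilb (Cfg d)) (S : Finset (Fin N)) :
    Submodule ℂ (Hilb (SubCfg d S)) :=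
  tensorSubspace fun i : {i // i ∈ S} => siteSupport d ψ i

/-- The neighborhood algebra of the `j`-th neighborhood: the operators `X ⊗ 𝕀` with
`X = c 𝕀 ⊕ X'` relative to the orthogonal decomposition of the neighborhood space into the
complement of the local support and the local support, such that `X ⊗ 𝕀` commutes on the local
support of the whole system with every Schmidt-span projector `Π_k`, `k ≠ j`. -/
def neighborhoodAlgebra {N K : ℕ} (d : Fin N → ℕ) (nbhd : Fin K → Finset (Fin N))
    (ψ : Hilb (Cfg d)) (j : Fin K) : Set (Op (Cfg d)) :=
  {A | ∃ X : Op (SubCfg d (nbhd j)),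
    A = ampliate (split d (nbhd j)) X ∧
    (∀ v ∈ localSupportOn d ψ (nbhd j), act X v ∈ localSupportOn d ψ (nbhd j)) ∧
    (∃ c : ℂ, ∀ v ∈ (localSupportOn d ψ (nbhd j))ᗮ, act X v = c • v) ∧
    ∀ k, k ≠ j → ∀ v ∈ localSupport d ψ,
      act A (act (schmidtProj d ψ (nbhd k)) v) = act (schmidtProj d ψ (nbhd k)) (act A v)}

/-- The restrictions to the subspace `L` of the operators in `𝒜` (those that preserve `L`). -/
def restrictTo {n : Type} [Fintype n] [DecidableEq n] (L : Submodule ℂ (Hilb n))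
    (𝒜 : Set (Op n)) : Set (Module.End ℂ L) :=
  {Y | ∃ A ∈ 𝒜, ∀ v : L, (Y v : Hilb n) = act A (v : Hilb n)}

/-- The `j`-th neighborhood algebra, restricted to the local support of `|ψ⟩⟨ψ|`. -/
def restrictedAlgebra {N K : ℕ} (d : Fin N → ℕ) (nbhd : Fin K → Finset (Fin N))
    (ψ : Hilb (Cfg d)) (j : Fin K) : Set (Module.End ℂ (localSupport d ψ)) :=
  restrictTo (localSupport d ψ) (neighborhoodAlgebra d nbhd ψ j)

/-- Elements of different members of the family commute. -/
def IsCommutingFamily {κ R : Type} [Mul R] (𝒜 : κ → Set R) : Prop :=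
  ∀ j k, j ≠ k → ∀ X ∈ 𝒜 j, ∀ Y ∈ 𝒜 k, X * Y = Y * X

/-- The union of the family generates the whole operator algebra. -/
def IsCompleteFamily {κ V : Type} [AddCommGroup V] [Module ℂ V] (𝒜 : κ → Set (Module.End ℂ V)) :
    Prop :=
  Algebra.adjoin ℂ (⋃ j, 𝒜 j) = ⊤

/-- The unitary `W` identifies the local support with `⨂ j, ℂ^(m j)` in such a way that the
`j`-th neighborhood algebra becomes the algebra of all operators on the `j`-th factor. -/
def IsInducedFactorization {N K : ℕ} (d : Fin N → ℕ) (nbhd : Fin K → Finset (Fin N))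
    (ψ : Hilb (Cfg d)) (m : Fin K → ℕ) (W : localSupport d ψ ≃ₗᵢ[ℂ] Hilb (Cfg m)) : Prop :=
  ∀ (j : Fin K) (Y : Module.End ℂ (localSupport d ψ)),
    Y ∈ restrictedAlgebra d nbhd ψ j ↔
      ∃ B : Op (Fin (m j)), ∀ v, W (Y v) = act (ampliate (single m j) B) (W v)

end QuasiLocal

end

open QuasiLocal

/-! Let `Π_j` denote the Schmidt-span projectors restricted to the local support and `𝒜_j` the
restricted neighborhood algebras, which are closed under adjoints. Two facts tie them to `ψ`. By
definition `Π_j` commutes with every `𝒜_k`, `k ≠ j`; since the algebras commute and generate all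
operators, this puts `Π_j` into `𝒜_j` (`mem_of_commute_others`, by a Casimir averaging). And QLS
makes `ψ`, up to a scalar, the only vector fixed by all `Π_j` (`IsQLS.eq_smul`): a neighborhood map
that fixes `|ψ⟩⟨ψ|` has Kraus operators acting as scalars on the Schmidt span, so the pure state of
a second joint fixed vector would never move.

Hence for `Y ∈ 𝒜_j` the vector `Π_j Y ψ` is fixed by all `Π_k` and equals `⟨ψ, Yψ⟩ ψ`
(`projection_apply_eq_inner_smul`). It follows that inner products of vectors `(∏ a_j) ψ` factor
over `j` (`inner_algProd_apply`), so orthonormal bases of the spaces `𝒜_j ψ` combine to an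
orthonormal basis of the local support. This is the factorization, built from `ψ` without structure
theory of algebras. In any induced factorization the same identity forces `ψ` to be a product vector
(`exists_prodVec_eq_of_local_projections`).

For RFTS, the map of neighborhood `j` first resets its sites to their site supports and then resets
the `j`-th factor to that of `ψ`, by operators acting on the local support as elements of `𝒜_j`. A
site reset commutes with maps not touching the site and is absorbed by those containing it, so all
needed resets can be thought of as done at the start. Inside the local support, map `j` lands in the
range of `Π_j`, and the other maps preserve this range because `𝒜_k` commutes with `Π_j`. At the end
only `ψ` is left. Whether a list of these maps prepares `ψ` depends only on the set of its indices
(`IsSufficient`), so a shortest sufficient list works in every order and none of its proper initial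
segments works. -/

noncomputable section

namespace QuasiLocal

set_option linter.unusedSectionVars false

/-! ### Operators as linear maps -/

section Operators

variable {n : Type} [Fintype n] [DecidableEq n]

theorem act_apply (X : Op n) (v : Hilb n) (a : n) : act X v a = ∑ b, X a b * v b := by
  simp [act, Matrix.mulVec, dotProduct]

theorem act_mul (X Y : Op n) (v : Hilb n) : act (X * Y) v = act X (act Y v) := by
  simp [act]

theorem act_one (v : Hilb n) : act (1 : Op n) v = v := by
  simp [act]

theorem act_smul_op (c : ℂ) (X : Op n) (v : Hilb n) : act (c • X) v = c • act X v := by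
  rw [act, map_smul]; rfl

theorem act_add_op (X Y : Op n) (v : Hilb n) : act (X + Y) v = act X v + act Y v := by
  rw [act, map_add]; rfl

theorem act_sub_op (X Y : Op n) (v : Hilb n) : act (X - Y) v = act X v - act Y v := by
  rw [act, map_sub]; rfl

theorem act_sum_op {α : Type} (s : Finset α) (X : α → Op n) (v : Hilb n) :
    act (∑ a ∈ s, X a) v = ∑ a ∈ s, act (X a) v := by
  rw [act, map_sum]; simp

theorem op_ext {X Y : Op n} (h : ∀ v, act X v = act Y v) : X = Y :=
  Matrix.toEuclideanLin.injective (LinearMap.ext h)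

theorem inner_act_right (X : Op n) (v w : Hilb n) : inner ℂ v (act X w) = inner ℂ (act Xᴴ v) w := by
  rw [act, act, Matrix.toEuclideanLin_conjTranspose_eq_adjoint, LinearMap.adjoint_inner_left]

theorem inner_act_left (X : Op n) (v w : Hilb n) : inner ℂ (act X v) w = inner ℂ v (act Xᴴ w) := by
  rw [inner_act_right, Matrix.conjTranspose_conjTranspose]

theorem act_proj (K : Submodule ℂ (Hilb n)) (v : Hilb n) : act (proj K) v = K.starProjection v := by
  simp [act, proj]

theorem act_proj_mem (K : Submodule ℂ (Hilb n)) (v : Hilb n) : act (proj K) v ∈ K := by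
  rw [act_proj]; exact K.starProjection_apply_mem v

theorem act_proj_eq_self_iff {K : Submodule ℂ (Hilb n)} {v : Hilb n} :
    act (proj K) v = v ↔ v ∈ K := by
  rw [act_proj, Submodule.starProjection_eq_self_iff]

theorem act_proj_eq_zero_iff {K : Submodule ℂ (Hilb n)} {v : Hilb n} :
    act (proj K) v = 0 ↔ v ∈ Kᗮ := by
  rw [act_proj, Submodule.starProjection_apply_eq_zero_iff]

theorem proj_mul_self (K : Submodule ℂ (Hilb n)) : proj K * proj K = proj K :=
  op_ext fun v => by rw [act_mul, act_proj_eq_self_iff]; exact act_proj_mem K v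

theorem proj_conjTranspose (K : Submodule ℂ (Hilb n)) : (proj K)ᴴ = proj K :=
  op_ext fun v => ext_inner_right ℂ fun w => by
    rw [← inner_act_right, act_proj, act_proj]
    exact (K.starProjection_isSymmetric v w).symm

theorem proj_top : proj (⊤ : Submodule ℂ (Hilb n)) = 1 :=
  op_ext fun v => by rw [act_one, act_proj_eq_self_iff]; trivial

end Operators

/-! ### Bipartite systems -/

section Bipartite

variable {A B C : Type} [Fintype A] [Fintype B] [Fintype C]
  [DecidableEq A] [DecidableEq B] [DecidableEq C] (e : C ≃ A × B)

theorem ampliate_mul (X Y : Op A) : ampliate e (X * Y) = ampliate e X * ampliate e Y := by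
  rw [ampliate, ampliate, ampliate, Matrix.submatrix_mul_equiv, ← Matrix.mul_kronecker_mul, one_mul]

theorem ampliate_one : ampliate e (1 : Op A) = 1 := by
  rw [ampliate, Matrix.one_kronecker_one, Matrix.submatrix_one_equiv]

theorem ampliate_conjTranspose (X : Op A) : (ampliate e X)ᴴ = ampliate e Xᴴ := by
  rw [ampliate, ampliate, Matrix.conjTranspose_submatrix, Matrix.conjTranspose_kronecker,
    Matrix.conjTranspose_one]

theorem ampliate_add (X Y : Op A) : ampliate e (X + Y) = ampliate e X + ampliate e Y := by
  ext; simp [ampliate, add_mul]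

theorem ampliate_sub (X Y : Op A) : ampliate e (X - Y) = ampliate e X - ampliate e Y := by
  ext; simp [ampliate, sub_mul]

theorem ampliate_smul (c : ℂ) (X : Op A) : ampliate e (c • X) = c • ampliate e X := by
  ext; simp [ampliate, mul_assoc]

theorem ampliate_sum {α : Type} (s : Finset α) (X : α → Op A) :
    ampliate e (∑ a ∈ s, X a) = ∑ a ∈ s, ampliate e (X a) := by
  ext; simp [ampliate, Matrix.sum_apply, Finset.sum_mul]

theorem ampliate_apply (X : Op A) (x y : C) :
    ampliate e X x y = X (e x).1 (e y).1 * if (e x).2 = (e y).2 then 1 else 0 := by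
  simp [ampliate, Matrix.one_apply]

theorem slice_apply (v : Hilb C) (b : B) (a : A) : slice e v b a = v (e.symm (a, b)) := rfl

theorem slice_act_ampliate (X : Op A) (v : Hilb C) (b : B) :
    slice e (act (ampliate e X) v) b = act X (slice e v b) := by
  ext a
  rw [slice_apply, act_apply, act_apply, ← Equiv.sum_comp e.symm, Fintype.sum_prod_type]
  simp [ampliate_apply, slice_apply]

theorem slice_ext {v w : Hilb C} (h : ∀ b, slice e v b = slice e w b) : v = w := by
  ext x
  have := congrArg (fun u : Hilb A => u (e x).1) (h (e x).2)
  simpa [slice_apply] using this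

/-- The linear map `v ↦ (𝕀 ⊗ ⟨b|) v`. -/
def sliceLin (b : B) : Hilb C →ₗ[ℂ] Hilb A where
  toFun v := slice e v b
  map_add' _ _ := by ext; simp [slice_apply]
  map_smul' _ _ := by ext; simp [slice_apply]

theorem slice_smul (c : ℂ) (v : Hilb C) (b : B) : slice e (c • v) b = c • slice e v b :=
  (sliceLin e b).map_smul c v

theorem act_ampliate_eq_self_iff {K : Submodule ℂ (Hilb A)} {v : Hilb C} :
    act (ampliate e (proj K)) v = v ↔ ∀ b, slice e v b ∈ K := by
  constructor
  · intro h b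
    rw [← h, slice_act_ampliate]
    exact act_proj_mem _ _
  · intro h
    refine slice_ext e fun b => ?_
    rw [slice_act_ampliate, act_proj_eq_self_iff]
    exact h b

end Bipartite

/-! ### Multipartite systems -/

section Multipartite

variable {ι : Type} [Fintype ι] [DecidableEq ι] {d : ι → ℕ}

theorem single_symm_apply_eq (i : ι) (x : Cfg d) (a : Fin (d i)) :
    (single d i).symm (a, ((single d i) x).2) = Function.update x i a := by
  rw [Equiv.symm_apply_eq]
  refine Prod.ext (by simp) ?_
  funext j
  simp [Function.update_of_ne j.2]

theorem act_ampliate_single (i : ι) (X : Op (Fin (d i))) (v : Hilb (Cfg d)) (x : Cfg d) :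
    act (ampliate (single d i) X) v x = ∑ a, X (x i) a * v (Function.update x i a) := by
  have h := congrArg (fun u : Hilb (Fin (d i)) => u (x i))
    (slice_act_ampliate (single d i) X v (single d i x).2)
  simp only [slice_apply, act_apply (X := X), single_symm_apply_eq, Function.update_eq_self] at h
  exact h

theorem prodVec_apply (v : ∀ i, Hilb (Fin (d i))) (x : Cfg d) :
    prodVec v x = ∏ i, v i (x i) := rfl

theorem act_ampliate_single_prodVec (i : ι) (X : Op (Fin (d i))) (v : ∀ i, Hilb (Fin (d i))) :
    act (ampliate (single d i) X) (prodVec v) = prodVec (Function.update v i (act X (v i))) := by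
  ext x
  rw [act_ampliate_single, prodVec_apply, ← Finset.mul_prod_erase _ _ (Finset.mem_univ i),
    Function.update_self, act_apply, Finset.sum_mul]
  refine Finset.sum_congr rfl fun a _ => ?_
  rw [prodVec_apply, ← Finset.mul_prod_erase _ _ (Finset.mem_univ i), Function.update_self,
    mul_assoc]
  congr 2
  refine Finset.prod_congr rfl fun j hj => ?_
  rw [Function.update_of_ne (Finset.ne_of_mem_erase hj),
    Function.update_of_ne (Finset.ne_of_mem_erase hj)]

theorem prodVec_single_one (x : Cfg d) :
    prodVec (fun i => EuclideanSpace.single (x i) (1 : ℂ)) = EuclideanSpace.single x 1 := by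
  ext y
  rw [prodVec_apply]
  simp only [PiLp.single_apply, Finset.prod_ite_zero, funext_iff]
  simp

theorem mem_span_prodVec (v : Hilb (Cfg d)) :
    v ∈ Submodule.span ℂ (Set.range (prodVec (d := d))) := by
  have : v = ∑ x, v x • prodVec (fun i => EuclideanSpace.single (x i) (1 : ℂ)) := by
    simp only [prodVec_single_one]
    ext y
    simp [Finset.sum_apply, Pi.single_apply]
  rw [this]
  exact Submodule.sum_mem _ fun x _ => Submodule.smul_mem _ _ (Submodule.subset_span ⟨_, rfl⟩)

/-- This trades a span of product vectors for one linear equation per site. For the converse, expand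
`v` in arbitrary product vectors and apply the projectors one site at a time: each forces one more
factor into its `L i` and leaves `v` unchanged. -/
theorem mem_tensorSubspace_iff {L : ∀ i, Submodule ℂ (Hilb (Fin (d i)))} {v : Hilb (Cfg d)} :
    v ∈ tensorSubspace L ↔ ∀ i, act (ampliate (single d i) (proj (L i))) v = v := by
  constructor
  · intro h i
    refine Submodule.span_induction ?_ (by simp) ?_ ?_ h
    · rintro _ ⟨w, hw, rfl⟩
      rw [act_ampliate_single_prodVec, act_proj_eq_self_iff.2 (hw i), Function.update_eq_self]
    · intro x y _ _ hx hy
      rw [map_add, hx, hy]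
    · intro c x _ hx
      rw [map_smul, hx]
  · intro h
    have key : ∀ s : Finset ι, v ∈ Submodule.span ℂ
        {w | ∃ u : ∀ i, Hilb (Fin (d i)), (∀ i ∈ s, u i ∈ L i) ∧ w = prodVec u} := by
      intro s
      induction s using Finset.induction with
      | empty =>
        refine Submodule.span_mono ?_ (mem_span_prodVec v)
        rintro _ ⟨u, rfl⟩
        exact ⟨u, by simp, rfl⟩
      | insert i s _ ih =>
        rw [← h i]
        have := Submodule.mem_map_of_mem (f := act (ampliate (single d i) (proj (L i)))) ih
        rw [Submodule.map_span] at this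
        refine Submodule.span_mono ?_ this
        rintro _ ⟨_, ⟨u, hu, rfl⟩, rfl⟩
        refine ⟨_, ?_, act_ampliate_single_prodVec _ _ _⟩
        intro k hk
        by_cases hki : k = i
        · subst hki
          rw [Function.update_self]
          exact act_proj_mem _ _
        · rw [Function.update_of_ne hki]
          exact hu k ((Finset.mem_insert.1 hk).resolve_left hki)
    refine Submodule.span_mono ?_ (key Finset.univ)
    rintro _ ⟨u, hu, rfl⟩
    exact ⟨u, fun i => hu i (Finset.mem_univ i), rfl⟩

theorem prodVec_smul_update (i : ι) (c : ℂ) (v : ∀ i, Hilb (Fin (d i))) :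
    prodVec (Function.update v i (c • v i)) = c • prodVec v := by
  have h := act_ampliate_single_prodVec i (c • 1) v
  rw [act_smul_op, act_one] at h
  rw [← h, ampliate_smul, ampliate_one, act_smul_op, act_one]

theorem norm_prodVec (v : ∀ i, Hilb (Fin (d i))) : ‖prodVec v‖ = ∏ i, ‖v i‖ := by
  simp only [EuclideanSpace.norm_eq]
  rw [← Real.sqrt_prod _ fun i _ => Finset.sum_nonneg fun a _ => sq_nonneg _,
    Finset.prod_univ_sum]
  simp [prodVec_apply, Finset.prod_pow]

end Multipartite

/-! ### Operators on single sites versus operators on sets of sites -/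

section Sites

variable {N : ℕ} {d : Fin N → ℕ}

theorem ampliate_single_of_mem {S : Finset (Fin N)} {i : Fin N} (hi : i ∈ S)
    (X : Op (Fin (d i))) :
    ampliate (single d i) X = ampliate (split d S)
      (ampliate (single (fun j : {j // j ∈ S} => d j) ⟨i, hi⟩) X) := by
  ext x y
  simp only [ampliate_apply, mul_assoc]
  congr 1
  rw [boole_mul, ← ite_and]
  refine if_congr ?_ rfl rfl
  simp only [funext_iff, Equiv.piSplitAt_apply, Equiv.piEquivPiSubtypeProd_apply, Subtype.forall,
    Subtype.mk.injEq, ne_eq]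
  constructor
  · exact fun h => ⟨fun j _ hj => h j hj, fun j hj => h j fun e => hj (e ▸ hi)⟩
  · intro h j hj
    by_cases hjS : j ∈ S
    · exact h.1 j hjS hj
    · exact h.2 j hjS

theorem ampliate_single_of_notMem {S : Finset (Fin N)} {i : Fin N} (hi : i ∉ S)
    (X : Op (Fin (d i))) :
    ampliate (single d i) X = ((1 : Op (SubCfg d S)) ⊗ₖ
      (ampliate (single (fun j : {j // ¬ j ∈ S} => d j) ⟨i, hi⟩) X)).submatrix
        (split d S) (split d S) := by
  ext x y
  simp only [ampliate_apply, Matrix.submatrix_apply, Matrix.kroneckerMap_apply, Matrix.one_apply]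
  rw [mul_comm, ← mul_assoc, mul_comm _ (X _ _), mul_comm _ (X _ _), mul_assoc]
  congr 1
  rw [boole_mul, ← ite_and]
  refine if_congr ?_ rfl rfl
  simp only [funext_iff, Equiv.piSplitAt_apply, Equiv.piEquivPiSubtypeProd_apply, Subtype.forall,
    Subtype.mk.injEq, ne_eq]
  constructor
  · exact fun h => ⟨fun j hj => h j fun e => hi (e ▸ hj), fun j _ hj => h j hj⟩
  · intro h j hj
    by_cases hjS : j ∈ S
    · exact h.1 j hjS
    · exact h.2 j hjS hj

theorem ampliate_split_commute_single {S : Finset (Fin N)} {i : Fin N} (hi : i ∉ S)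
    (X : Op (SubCfg d S)) (Y : Op (Fin (d i))) :
    ampliate (split d S) X * ampliate (single d i) Y =
      ampliate (single d i) Y * ampliate (split d S) X := by
  rw [ampliate_single_of_notMem hi, ampliate, Matrix.submatrix_mul_equiv,
    Matrix.submatrix_mul_equiv, ← Matrix.mul_kronecker_mul, ← Matrix.mul_kronecker_mul]
  simp only [one_mul, mul_one]

theorem ampliate_single_commute {i k : Fin N} (h : i ≠ k) (X : Op (Fin (d i)))
    (Y : Op (Fin (d k))) :
    ampliate (single d i) X * ampliate (single d k) Y =
      ampliate (single d k) Y * ampliate (single d i) X := by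
  rw [ampliate_single_of_mem (Finset.mem_singleton_self i)]
  exact ampliate_split_commute_single (by simpa using h.symm) _ _

end Sites

/-! ### Local support -/

section LocalSupport

variable {N : ℕ} {d : Fin N → ℕ} {ψ : Hilb (Cfg d)}

/-- The reduced operator is `R = ∑ b, |s_b⟩⟨s_b|` over the slices `s_b`. It is Hermitian, so its
range is the orthogonal complement of its kernel; and `R w = 0` gives `∑ b, |⟨s_b, w⟩|² = ⟨w, R w⟩ =
0`. -/
theorem slice_mem_range_partialTrace {A B C : Type} [Fintype A] [Fintype B] [DecidableEq A]
    (e : C ≃ A × B) (ψ : Hilb C) (b : B) :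
    slice e ψ b ∈ LinearMap.range (act (partialTrace e (ketbra ψ))) := by
  set R := partialTrace e (ketbra ψ) with hR
  have hent : ∀ a a', R a a' = ∑ b, slice e ψ b a * star (slice e ψ b a') := fun a a' => rfl
  have hherm : Rᴴ = R := by
    ext a a'
    rw [Matrix.conjTranspose_apply, hent, hent, star_sum]
    exact Finset.sum_congr rfl fun b _ => by rw [star_mul, star_star]
  have hquad : ∀ w : Hilb A, inner ℂ w (act R w) =
      ∑ b, ((‖inner ℂ (slice e ψ b) w‖ ^ 2 : ℝ) : ℂ) := by
    intro w
    have h1 : act R w = ∑ b, inner ℂ (slice e ψ b) w • slice e ψ b := by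
      ext a
      rw [act_apply]
      simp only [hent, WithLp.ofLp_sum, WithLp.ofLp_smul, Finset.sum_apply, Pi.smul_apply,
        smul_eq_mul, PiLp.inner_apply, RCLike.inner_apply, Finset.sum_mul]
      rw [Finset.sum_comm]
      refine Finset.sum_congr rfl fun b _ => Finset.sum_congr rfl fun a' _ => ?_
      simp only [starRingEnd_apply]
      ring
    rw [h1, inner_sum]
    refine Finset.sum_congr rfl fun b _ => ?_
    rw [inner_smul_right, ← inner_conj_symm w, RCLike.mul_conj]
    norm_cast
  have hrange : LinearMap.range (act R) = (LinearMap.ker (act R))ᗮ := by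
    rw [← LinearMap.adjoint_adjoint (act R), ← LinearMap.orthogonal_ker, LinearMap.adjoint_adjoint,
      act, ← Matrix.toEuclideanLin_conjTranspose_eq_adjoint, hherm]
  rw [hrange, Submodule.mem_orthogonal]
  intro w hw
  have h0 := hquad w
  rw [LinearMap.mem_ker.1 hw, inner_zero_right] at h0
  have h1 : ∑ b, ‖inner ℂ (slice e ψ b) w‖ ^ 2 = 0 := by exact_mod_cast h0.symm
  have h2 := (Finset.sum_eq_zero_iff_of_nonneg fun b _ => sq_nonneg _).1 h1 b (Finset.mem_univ b)
  rw [← inner_conj_symm, norm_eq_zero.1 (pow_eq_zero_iff two_ne_zero |>.1 h2), map_zero]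

/-- The projector onto the site support, acting on the whole system. -/
def siteProj (d : Fin N → ℕ) (ψ : Hilb (Cfg d)) (i : Fin N) : Op (Cfg d) :=
  ampliate (single d i) (proj (siteSupport d ψ i))

theorem mem_localSupport_iff {v : Hilb (Cfg d)} :
    v ∈ localSupport d ψ ↔ ∀ i, act (siteProj d ψ i) v = v :=
  mem_tensorSubspace_iff

theorem mem_localSupportOn_iff {S : Finset (Fin N)} {u : Hilb (SubCfg d S)} :
    u ∈ localSupportOn d ψ S ↔ ∀ i : {i // i ∈ S},
      act (ampliate (single (fun i : {i // i ∈ S} => d i) i) (proj (siteSupport d ψ i))) u = u :=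
  mem_tensorSubspace_iff

theorem slice_single_mem_siteSupport (i : Fin N) (b) :
    slice (single d i) ψ b ∈ siteSupport d ψ i :=
  slice_mem_range_partialTrace _ _ _

variable (d ψ) in
theorem self_mem_localSupport : ψ ∈ localSupport d ψ :=
  mem_localSupport_iff.2 fun i => (act_ampliate_eq_self_iff _).2 fun b =>
    slice_single_mem_siteSupport i b

theorem slice_mem_localSupportOn {S : Finset (Fin N)} {v : Hilb (Cfg d)}
    (hv : v ∈ localSupport d ψ) (b) : slice (split d S) v b ∈ localSupportOn d ψ S := by
  refine mem_localSupportOn_iff.2 fun i => ?_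
  rw [← slice_act_ampliate, ← ampliate_single_of_mem i.2]
  exact congrArg (fun w => slice (split d S) w b) (mem_localSupport_iff.1 hv i)

variable (d ψ) in
theorem schmidtSpan_le_localSupportOn (S : Finset (Fin N)) :
    schmidtSpan (split d S) ψ ≤ localSupportOn d ψ S := by
  refine Submodule.span_le.2 ?_
  rintro _ ⟨b, rfl⟩
  exact slice_mem_localSupportOn (self_mem_localSupport d ψ) b

/-- The site equations are checked one by one: inside `S` they are seen on the slices, and outside
`S` the site projector commutes with `X ⊗ 𝕀`. -/
theorem act_ampliate_mem_localSupport {S : Finset (Fin N)} {X : Op (SubCfg d S)}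
    (hX : ∀ u ∈ localSupportOn d ψ S, act X u ∈ localSupportOn d ψ S) {v : Hilb (Cfg d)}
    (hv : v ∈ localSupport d ψ) : act (ampliate (split d S) X) v ∈ localSupport d ψ := by
  refine mem_localSupport_iff.2 fun i => ?_
  by_cases hi : i ∈ S
  · refine slice_ext (split d S) fun b => ?_
    rw [siteProj, ampliate_single_of_mem hi, slice_act_ampliate, slice_act_ampliate]
    exact mem_localSupportOn_iff.1 (hX _ (slice_mem_localSupportOn hv b)) ⟨i, hi⟩
  · rw [siteProj, ← act_mul, ← ampliate_split_commute_single hi, act_mul]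
    exact congrArg _ (mem_localSupport_iff.1 hv i)

theorem act_schmidtProj_mem_localSupport (S : Finset (Fin N)) {v : Hilb (Cfg d)}
    (hv : v ∈ localSupport d ψ) : act (schmidtProj d ψ S) v ∈ localSupport d ψ :=
  act_ampliate_mem_localSupport
    (fun _ _ => schmidtSpan_le_localSupportOn d ψ S (act_proj_mem _ _)) hv

theorem act_schmidtProj_self (S : Finset (Fin N)) : act (schmidtProj d ψ S) ψ = ψ :=
  (act_ampliate_eq_self_iff _).2 fun b => Submodule.subset_span ⟨b, rfl⟩

theorem schmidtProj_conjTranspose (S : Finset (Fin N)) :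
    (schmidtProj d ψ S)ᴴ = schmidtProj d ψ S := by
  rw [schmidtProj, ampliate_conjTranspose, proj_conjTranspose]

theorem schmidtProj_mul_self (S : Finset (Fin N)) :
    schmidtProj d ψ S * schmidtProj d ψ S = schmidtProj d ψ S := by
  rw [schmidtProj, ← ampliate_mul, proj_mul_self]

/-- Used to carry identities from the local support of the whole system down to that of a
neighborhood. The witness is `(|u⟩⟨a| ⊗ 𝕀) ψ`, where `(a, b)` is a basis configuration at which `ψ`
does not vanish. -/
theorem exists_slice_eq_smul (hψ : ψ ≠ 0) {S : Finset (Fin N)} {u : Hilb (SubCfg d S)}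
    (hu : u ∈ localSupportOn d ψ S) :
    ∃ v ∈ localSupport d ψ, ∃ b, ∃ c : ℂ, c ≠ 0 ∧ slice (split d S) v b = c • u := by
  obtain ⟨x, hx⟩ : ∃ x, ψ x ≠ 0 := by
    by_contra! h
    exact hψ (PiLp.ext h)
  obtain ⟨a, b, rfl⟩ : ∃ a b, (split d S).symm (a, b) = x :=
    ⟨_, _, (split d S).symm_apply_apply x⟩
  have hact : ∀ w : Hilb (SubCfg d S),
      act (Matrix.vecMulVec u (Pi.single a 1)) w = w a • u := by
    intro w
    ext y
    rw [act_apply]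
    simp [Matrix.vecMulVec_apply, Pi.single_apply, mul_comm]
  refine ⟨act (ampliate (split d S) (Matrix.vecMulVec u (Pi.single a 1))) ψ,
    act_ampliate_mem_localSupport (fun w _ => ?_) (self_mem_localSupport d ψ), b, _, hx, ?_⟩
  · rw [hact]
    exact Submodule.smul_mem _ _ hu
  · rw [slice_act_ampliate, hact]
    rfl

end LocalSupport

/-! ### Neighborhood algebras -/

section NeighborhoodAlgebra

variable {N K : ℕ} {d : Fin N → ℕ} {nbhd : Fin K → Finset (Fin N)} {ψ : Hilb (Cfg d)}

theorem act_mem_localSupport {j : Fin K} {A : Op (Cfg d)}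
    (hA : A ∈ neighborhoodAlgebra d nbhd ψ j) {v : Hilb (Cfg d)} (hv : v ∈ localSupport d ψ) :
    act A v ∈ localSupport d ψ := by
  obtain ⟨X, rfl, hX, -⟩ := hA
  exact act_ampliate_mem_localSupport hX hv

theorem smul_one_mem_neighborhoodAlgebra (j : Fin K) (c : ℂ) :
    c • (1 : Op (Cfg d)) ∈ neighborhoodAlgebra d nbhd ψ j := by
  refine ⟨c • 1, by rw [ampliate_smul, ampliate_one], fun v hv => ?_, ⟨c, fun v _ => ?_⟩,
    fun k _ v _ => ?_⟩
  · rw [act_smul_op, act_one]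
    exact Submodule.smul_mem _ _ hv
  · rw [act_smul_op, act_one]
  · rw [act_smul_op, act_smul_op, act_one, act_one, map_smul]

theorem mul_mem_neighborhoodAlgebra {j : Fin K} {A B : Op (Cfg d)}
    (hA : A ∈ neighborhoodAlgebra d nbhd ψ j) (hB : B ∈ neighborhoodAlgebra d nbhd ψ j) :
    A * B ∈ neighborhoodAlgebra d nbhd ψ j := by
  have hB' := fun v hv => act_mem_localSupport (v := v) hB hv
  obtain ⟨X, rfl, hX, ⟨c, hc⟩, hXk⟩ := hA
  obtain ⟨Y, rfl, hY, ⟨c', hc'⟩, hYk⟩ := hB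
  refine ⟨X * Y, (ampliate_mul _ _ _).symm, fun v hv => ?_, ⟨c' * c, fun v hv => ?_⟩,
    fun k hk v hv => ?_⟩
  · rw [act_mul]
    exact hX _ (hY _ hv)
  · rw [act_mul, hc' v hv, map_smul, hc v hv, smul_smul]
  · rw [act_mul, act_mul, hYk k hk v hv, hXk k hk _ (hB' v hv)]

theorem add_mem_neighborhoodAlgebra {j : Fin K} {A B : Op (Cfg d)}
    (hA : A ∈ neighborhoodAlgebra d nbhd ψ j) (hB : B ∈ neighborhoodAlgebra d nbhd ψ j) :
    A + B ∈ neighborhoodAlgebra d nbhd ψ j := by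
  obtain ⟨X, rfl, hX, ⟨c, hc⟩, hXk⟩ := hA
  obtain ⟨Y, rfl, hY, ⟨c', hc'⟩, hYk⟩ := hB
  refine ⟨X + Y, (ampliate_add _ _ _).symm, fun v hv => ?_, ⟨c + c', fun v hv => ?_⟩,
    fun k hk v hv => ?_⟩
  · rw [act_add_op]
    exact Submodule.add_mem _ (hX _ hv) (hY _ hv)
  · rw [act_add_op, hc v hv, hc' v hv, add_smul]
  · rw [act_add_op, act_add_op, hXk k hk v hv, hYk k hk v hv, map_add]

theorem conjTranspose_mem_neighborhoodAlgebra {j : Fin K} {A : Op (Cfg d)}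
    (hA : A ∈ neighborhoodAlgebra d nbhd ψ j) : Aᴴ ∈ neighborhoodAlgebra d nbhd ψ j := by
  have hA' := fun v hv => act_mem_localSupport (v := v) hA hv
  obtain ⟨X, rfl, hX, ⟨c, hc⟩, hXk⟩ := hA
  set L := localSupportOn d ψ (nbhd j) with hL
  have hXL : ∀ v ∈ L, act Xᴴ v ∈ L := by
    intro v hv
    rw [← Submodule.orthogonal_orthogonal L, Submodule.mem_orthogonal]
    intro w hw
    rw [← inner_act_left, hc w hw, inner_smul_left, Submodule.inner_left_of_mem_orthogonal hv hw,
      mul_zero]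
  have hXL' : ∀ v ∈ Lᗮ, act Xᴴ v = star c • v := by
    intro w hw
    refine ext_inner_right ℂ fun u => ?_
    obtain ⟨u₁, h₁, u₂, h₂, rfl⟩ := L.exists_add_mem_mem_orthogonal u
    rw [← inner_act_right, map_add, hc u₂ h₂, inner_add_right, inner_smul_left, inner_add_right,
      Submodule.inner_left_of_mem_orthogonal (hX _ h₁) hw,
      Submodule.inner_left_of_mem_orthogonal h₁ hw, inner_smul_right]
    simp
  refine ⟨Xᴴ, ampliate_conjTranspose _ _, hXL, ⟨_, hXL'⟩, fun k hk v hv => ?_⟩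
  have hmem : ∀ {w}, w ∈ localSupport d ψ →
      act (ampliate (split d (nbhd j)) X)ᴴ w ∈ localSupport d ψ := by
    intro w hw
    rw [ampliate_conjTranspose]
    exact act_ampliate_mem_localSupport hXL hw
  rw [← sub_eq_zero]
  -- Commutation is known only on the local support, so taking adjoints of the whole identity is not
  -- allowed. The commutator vector `z` lies in the local support itself, however, and pairing it
  -- with itself moves both operators onto this `z`.
  set z := act (ampliate (split d (nbhd j)) X)ᴴ (act (schmidtProj d ψ (nbhd k)) v) -
    act (schmidtProj d ψ (nbhd k)) (act (ampliate (split d (nbhd j)) X)ᴴ v) with hz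
  have hzL : z ∈ localSupport d ψ :=
    Submodule.sub_mem _ (hmem (act_schmidtProj_mem_localSupport _ hv))
      (act_schmidtProj_mem_localSupport _ (hmem hv))
  rw [← inner_self_eq_zero (𝕜 := ℂ)]
  nth_rw 1 [hz]
  rw [inner_sub_left, inner_act_left, Matrix.conjTranspose_conjTranspose, inner_act_left,
    schmidtProj_conjTranspose, inner_act_left, inner_act_left, Matrix.conjTranspose_conjTranspose,
    schmidtProj_conjTranspose, hXk k hk z hzL, sub_self]

variable (d nbhd ψ) in
/-- The restriction of the neighborhood algebra to the local support, as a subalgebra. -/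
def restrictedSubalgebra (j : Fin K) : Subalgebra ℂ (Module.End ℂ (localSupport d ψ)) where
  carrier := restrictedAlgebra d nbhd ψ j
  mul_mem' := by
    rintro Y Z ⟨A, hA, hY⟩ ⟨B, hB, hZ⟩
    exact ⟨A * B, mul_mem_neighborhoodAlgebra hA hB, fun v => by
      rw [Module.End.mul_apply, hY, hZ, act_mul]⟩
  add_mem' := by
    rintro Y Z ⟨A, hA, hY⟩ ⟨B, hB, hZ⟩
    exact ⟨A + B, add_mem_neighborhoodAlgebra hA hB, fun v => by
      rw [LinearMap.add_apply, Submodule.coe_add, hY, hZ, act_add_op]⟩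
  algebraMap_mem' c := ⟨c • 1, smul_one_mem_neighborhoodAlgebra j c, fun v => by
    rw [act_smul_op, act_one, Module.algebraMap_end_apply, Submodule.coe_smul]⟩

theorem exists_adjoint_mem_restrictedAlgebra {j : Fin K} {Y : Module.End ℂ (localSupport d ψ)}
    (hY : Y ∈ restrictedAlgebra d nbhd ψ j) :
    ∃ Z ∈ restrictedAlgebra d nbhd ψ j, ∀ v w, inner ℂ (Z v) w = inner ℂ v (Y w) := by
  obtain ⟨A, hA, h⟩ := hY
  have hA' := conjTranspose_mem_neighborhoodAlgebra hA
  refine ⟨(act Aᴴ).restrict fun _ hv => act_mem_localSupport hA' hv, ⟨_, hA', fun _ => rfl⟩,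
    fun v w => ?_⟩
  rw [Submodule.coe_inner, Submodule.coe_inner, h, inner_act_right]
  rfl

variable (d ψ) in
/-- The restriction of a Schmidt-span projector to the local support. -/
def localSchmidtProj (S : Finset (Fin N)) : Module.End ℂ (localSupport d ψ) :=
  (act (schmidtProj d ψ S)).restrict fun _ hv => act_schmidtProj_mem_localSupport S hv

theorem coe_localSchmidtProj (S : Finset (Fin N)) (v : localSupport d ψ) :
    (localSchmidtProj d ψ S v : Hilb (Cfg d)) = act (schmidtProj d ψ S) (v : Hilb (Cfg d)) := rfl

theorem localSchmidtProj_mul_self (S : Finset (Fin N)) :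
    localSchmidtProj d ψ S * localSchmidtProj d ψ S = localSchmidtProj d ψ S := by
  ext1 v
  apply Subtype.ext
  rw [Module.End.mul_apply, coe_localSchmidtProj, coe_localSchmidtProj, ← act_mul,
    schmidtProj_mul_self]

theorem inner_localSchmidtProj_left (S : Finset (Fin N)) :
    ∀ v w, inner ℂ (localSchmidtProj d ψ S v) w = inner ℂ v (localSchmidtProj d ψ S w) := by
  intro v w
  rw [Submodule.coe_inner, Submodule.coe_inner, coe_localSchmidtProj, coe_localSchmidtProj,
    inner_act_left, schmidtProj_conjTranspose]

theorem localSchmidtProj_commute {j k : Fin K} (hk : k ≠ j)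
    {Y : Module.End ℂ (localSupport d ψ)} (hY : Y ∈ restrictedAlgebra d nbhd ψ j) :
    Y * localSchmidtProj d ψ (nbhd k) = localSchmidtProj d ψ (nbhd k) * Y := by
  obtain ⟨A, ⟨X, hA, hX, hc, h⟩, hY⟩ := hY
  ext1 v
  apply Subtype.ext
  rw [Module.End.mul_apply, Module.End.mul_apply, hY, coe_localSchmidtProj, coe_localSchmidtProj,
    hY, h k hk v v.2]

end NeighborhoodAlgebra

/-! ### Commuting self-adjoint subalgebras of a full operator algebra -/

section Centralizer

variable {V : Type} [NormedAddCommGroup V] [InnerProductSpace ℂ V] [FiniteDimensional ℂ V]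

/-- The trace is the squared Hilbert–Schmidt norm of `Y`. This makes the trace form nondegenerate on
any algebra closed under adjoints. -/
theorem eq_zero_of_trace_adjoint_mul_self {Y Z : Module.End ℂ V}
    (hZ : ∀ v w, inner ℂ (Z v) w = inner ℂ v (Y w)) (h : LinearMap.trace ℂ V (Z * Y) = 0) :
    Y = 0 := by
  let b := stdOrthonormalBasis ℂ V
  rw [LinearMap.trace_eq_sum_inner _ b] at h
  have h1 : ∀ i, inner ℂ (b i) ((Z * Y) (b i)) = ((‖Y (b i)‖ ^ 2 : ℝ) : ℂ) := by
    intro i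
    rw [Module.End.mul_apply, ← inner_conj_symm, hZ, inner_self_eq_norm_sq_to_K]
    simp
  simp only [h1] at h
  have h2 : ∑ i, ‖Y (b i)‖ ^ 2 = 0 := by exact_mod_cast h
  have h3 := (Finset.sum_eq_zero_iff_of_nonneg fun i _ => sq_nonneg _).1 h2
  refine b.toBasis.ext fun i => ?_
  have := h3 i (Finset.mem_univ i)
  rw [OrthonormalBasis.coe_toBasis, LinearMap.zero_apply]
  exact norm_eq_zero.1 ((pow_eq_zero_iff two_ne_zero).1 this)

/-- A subalgebra closed under adjoints has a Casimir element: `C ↦ ∑ i, x i * C * y i` maps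
into the commutant of the subalgebra, and its value at `1` has trace equal to the dimension. -/
theorem exists_casimir (B : Subalgebra ℂ (Module.End ℂ V))
    (hB : ∀ Y ∈ B, ∃ Z ∈ B, ∀ v w, inner ℂ (Z v) w = inner ℂ v (Y w)) :
    ∃ (r : ℕ) (x y : Fin r → Module.End ℂ V), (∀ i, x i ∈ B) ∧ (∀ i, y i ∈ B) ∧
      (∀ C, ∀ b ∈ B, b * ∑ i, x i * C * y i = (∑ i, x i * C * y i) * b) ∧
      (∑ i, LinearMap.trace ℂ V (x i * y i) = Module.finrank ℂ B) := by
  -- The Casimir element is formed from a basis of `B` and its dual basis for the trace form.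
  let τ : LinearMap.BilinForm ℂ B := LinearMap.mk₂ ℂ
    (fun x y => LinearMap.trace ℂ V ((x : Module.End ℂ V) * (y : Module.End ℂ V)))
    (fun x x' y => by simp [add_mul]) (fun c x y => by simp)
    (fun x y y' => by simp [mul_add]) (fun c x y => by simp)
  have hτ : ∀ x y : B, τ x y = LinearMap.trace ℂ V ((x : Module.End ℂ V) * y) := fun _ _ => rfl
  have hsymm : τ.IsSymm := ⟨fun x y => by
    rw [hτ, hτ, LinearMap.trace_mul_comm]⟩
  have hsep : ∀ y : B, (∀ x, τ x y = 0) → y = 0 := by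
    intro y hy
    obtain ⟨Z, hZB, hZ⟩ := hB y y.2
    exact Subtype.ext (eq_zero_of_trace_adjoint_mul_self hZ (hy ⟨Z, hZB⟩))
  have hnd : τ.Nondegenerate :=
    ⟨fun y hy => hsep y fun x => by rw [hsymm.eq y x |>.symm]; exact hy x, hsep⟩
  let b := Module.finBasis ℂ B
  let b' := τ.dualBasis hnd b
  have hb' : ∀ z : B, z = ∑ i, τ z (b i) • b' i := by
    intro z
    conv_lhs => rw [← b'.sum_repr z]
    simp only [b', LinearMap.BilinForm.dualBasis_repr_apply]
  have hb : ∀ z : B, z = ∑ i, τ z (b' i) • b i := by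
    intro z
    conv_lhs => rw [← b.sum_repr z]
    refine Finset.sum_congr rfl fun i _ => ?_
    rw [← τ.dualBasis_repr_apply hnd b' z i]
    simp only [b', τ.dualBasis_dualBasis hnd hsymm]
  refine ⟨_, fun i => b i, fun i => b' i, fun i => (b i).2, fun i => (b' i).2, ?_, ?_⟩
  · intro C z hz
    -- Left multiplication by `z` on the basis and right multiplication by `z` on the dual basis
    -- have the same matrix `T`; hence `z` passes through the sum.
    obtain ⟨T, hT⟩ : ∃ T : Fin _ → Fin _ → ℂ, ∀ k i, T k i = LinearMap.trace ℂ V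
        ((b' k : Module.End ℂ V) * z * b i) := ⟨_, fun _ _ => rfl⟩
    have h1 : ∀ i, z * (b i : Module.End ℂ V) = ∑ k, T k i • (b k : Module.End ℂ V) := by
      intro i
      have := congrArg (Subtype.val) (hb (⟨z, hz⟩ * b i))
      simp only [Subalgebra.coe_mul, AddSubmonoidClass.coe_finsetSum, Subalgebra.coe_smul, hτ]
        at this
      rw [this]
      refine Finset.sum_congr rfl fun k _ => ?_
      rw [hT, LinearMap.trace_mul_comm, mul_assoc]
    have h2 : ∀ k, (b' k : Module.End ℂ V) * z = ∑ i, T k i • (b' i : Module.End ℂ V) := by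
      intro k
      have := congrArg (Subtype.val) (hb' (b' k * ⟨z, hz⟩))
      simpa only [Subalgebra.coe_mul, AddSubmonoidClass.coe_finsetSum, Subalgebra.coe_smul, hτ, hT]
        using this
    rw [Finset.mul_sum, Finset.sum_mul]
    simp only [← mul_assoc, h1]
    simp only [mul_assoc, h2]
    simp only [Finset.sum_mul, Finset.mul_sum, smul_mul_assoc, mul_smul_comm]
    rw [Finset.sum_comm]
  · have : ∀ i, LinearMap.trace ℂ V ((b i : Module.End ℂ V) * b' i) = 1 := by
      intro i
      rw [← hτ]
      simpa [b'] using τ.apply_dualBasis_right hnd hsymm b i i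
    simp [this]

/-- Average over `B` with its Casimir element. The average of `b ∈ B` commutes with both algebras
and is therefore scalar, so `a * b` averages to a multiple of `a`. The products `a * b` span all
operators, so the average of `C` lies in `A`. As `C` commutes with `B`, this average is also a
nonzero multiple of `C`. -/
theorem mem_of_commute_of_adjoin_eq_top (A B : Subalgebra ℂ (Module.End ℂ V))
    (hAB : ∀ a ∈ A, ∀ b ∈ B, a * b = b * a)
    (hgen : Algebra.adjoin ℂ ((A : Set (Module.End ℂ V)) ∪ B) = ⊤)
    (hB : ∀ Y ∈ B, ∃ Z ∈ B, ∀ v w, inner ℂ (Z v) w = inner ℂ v (Y w))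
    {C : Module.End ℂ V} (hC : ∀ b ∈ B, C * b = b * C) : C ∈ A := by
  rcases subsingleton_or_nontrivial V with hV | hV
  · rw [Subsingleton.elim C 0]
    exact zero_mem A
  obtain ⟨r, x, y, hx, hy, hxy, htr⟩ := exists_casimir B hB
  have hscalar : ∀ z, (∀ a ∈ A, a * z = z * a) → (∀ b ∈ B, b * z = z * b) →
      ∃ c : ℂ, z = c • 1 := by
    intro z hzA hzB
    have : z ∈ Subalgebra.center ℂ (Module.End ℂ V) := by
      rw [Subalgebra.mem_center_iff]
      intro t
      have ht : t ∈ Algebra.adjoin ℂ ((A : Set (Module.End ℂ V)) ∪ B) := hgen ▸ trivial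
      induction ht using Algebra.adjoin_induction with
      | mem t ht => exact ht.elim (hzA t) (hzB t)
      | algebraMap c => exact Algebra.commutes c z
      | add t u _ _ h1 h2 => rw [add_mul, mul_add, h1, h2]
      | mul t u _ _ h1 h2 => rw [mul_assoc, h2, ← mul_assoc, h1, mul_assoc]
    rw [Algebra.IsCentral.center_eq_bot, Algebra.mem_bot] at this
    obtain ⟨c, rfl⟩ := this
    exact ⟨c, Algebra.algebraMap_eq_smul_one c⟩
  have hΩB : ∀ b ∈ B, ∃ c : ℂ, ∑ i, x i * b * y i = c • 1 := by
    intro b hb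
    refine hscalar _ (fun a ha => ?_) fun b' hb' => hxy b b' hb'
    exact hAB a ha _ (sum_mem fun i _ => mul_mem (mul_mem (hx i) hb) (hy i))
  let Q := Submodule.span ℂ {s | ∃ a ∈ A, ∃ b ∈ B, s = a * b}
  have hQΩ : ∀ s ∈ Q, ∑ i, x i * s * y i ∈ A := by
    intro s hs
    induction hs using Submodule.span_induction with
    | mem s hs =>
      obtain ⟨a, ha, b, hb, rfl⟩ := hs
      obtain ⟨c, hc⟩ := hΩB b hb
      have : ∑ i, x i * (a * b) * y i = a * ∑ i, x i * b * y i := by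
        rw [Finset.mul_sum]
        refine Finset.sum_congr rfl fun i _ => ?_
        rw [← mul_assoc (x i), ← hAB a ha _ (hx i)]
        simp only [mul_assoc]
      rw [this, hc, mul_smul_comm, mul_one]
      exact A.smul_mem ha c
    | zero => simp
    | add s t _ _ h1 h2 =>
      simp only [add_mul, mul_add, Finset.sum_add_distrib]
      exact add_mem h1 h2
    | smul c s _ h1 =>
      simp only [mul_smul_comm, smul_mul_assoc, ← Finset.smul_sum]
      exact A.smul_mem h1 c
  -- `Q` is a left ideal; since it contains `1`, it is the whole operator algebra.
  have hQ : ∀ t, ∀ s ∈ Q, t * s ∈ Q := by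
    intro t
    have ht : t ∈ Algebra.adjoin ℂ ((A : Set (Module.End ℂ V)) ∪ B) := hgen ▸ trivial
    induction ht using Algebra.adjoin_induction with
    | mem t ht =>
      intro s hs
      induction hs using Submodule.span_induction with
      | mem s hs =>
        obtain ⟨a, ha, b, hb, rfl⟩ := hs
        rcases ht with ht | ht
        · exact Submodule.subset_span ⟨t * a, mul_mem ht ha, b, hb, (mul_assoc _ _ _).symm⟩
        · exact Submodule.subset_span ⟨a, ha, t * b, mul_mem ht hb, by
            rw [← mul_assoc t, ← hAB a ha t ht, mul_assoc]⟩
      | zero => simp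
      | add s t _ _ h1 h2 => rw [mul_add]; exact add_mem h1 h2
      | smul c s _ h1 => rw [mul_smul_comm]; exact Q.smul_mem c h1
    | algebraMap c =>
      intro s hs
      rw [← Algebra.smul_def]
      exact Q.smul_mem c hs
    | add t u _ _ h1 h2 =>
      intro s hs
      rw [add_mul]
      exact add_mem (h1 s hs) (h2 s hs)
    | mul t u _ _ h1 h2 =>
      intro s hs
      rw [mul_assoc]
      exact h1 _ (h2 s hs)
  have h1Q : (1 : Module.End ℂ V) ∈ Q :=
    Submodule.subset_span ⟨1, one_mem A, 1, one_mem B, (mul_one 1).symm⟩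
  have hC1 := hQΩ _ (hQ C 1 h1Q)
  obtain ⟨c, hc⟩ := hΩB 1 (one_mem B)
  have h1 : ∑ i, x i * (C * 1) * y i = c • C := by
    have : ∑ i, x i * (C * 1) * y i = C * ∑ i, x i * 1 * y i := by
      rw [Finset.mul_sum]
      refine Finset.sum_congr rfl fun i _ => ?_
      rw [mul_one, mul_one, ← hC _ (hx i), mul_assoc]
    rw [this, hc, mul_smul_comm, mul_one]
  -- If `c` were zero, so would be the trace of `∑ i, x i * y i`, which is the dimension of `B`.
  have hc0 : c ≠ 0 := by
    rintro rfl
    have := congrArg (LinearMap.trace ℂ V) hc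
    simp only [mul_one, map_sum, zero_smul, map_zero, htr] at this
    have h0 : Module.finrank ℂ B = 0 := by exact_mod_cast this
    have hpos : 0 < Module.finrank ℂ B := Module.finrank_pos
    omega
  rw [h1] at hC1
  simpa [smul_smul, inv_mul_cancel₀ hc0] using A.smul_mem hC1 c⁻¹

end Centralizer

/-! ### Factorization induced by commuting algebras and a product state -/

section Factorization

variable {V : Type} [NormedAddCommGroup V] [InnerProductSpace ℂ V] [FiniteDimensional ℂ V] {K : ℕ}
  {𝒜 : Fin K → Subalgebra ℂ (Module.End ℂ V)}

/-- The algebras with index other than `j` together generate one algebra, which is again closed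
under adjoints and commutes with `𝒜 j`; this reduces the claim to two algebras. -/
theorem mem_of_commute_others
    (hcomm : ∀ j k, j ≠ k → ∀ X ∈ 𝒜 j, ∀ Y ∈ 𝒜 k, X * Y = Y * X)
    (hgen : Algebra.adjoin ℂ (⋃ j, (𝒜 j : Set (Module.End ℂ V))) = ⊤)
    (hstar : ∀ j, ∀ Y ∈ 𝒜 j, ∃ Z ∈ 𝒜 j, ∀ v w, inner ℂ (Z v) w = inner ℂ v (Y w))
    {j : Fin K} {C : Module.End ℂ V} (hC : ∀ k, k ≠ j → ∀ Y ∈ 𝒜 k, Y * C = C * Y) : C ∈ 𝒜 j := by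
  set G : Set (Module.End ℂ V) := {Y | ∃ k, k ≠ j ∧ Y ∈ 𝒜 k} with hG
  have hcent : ∀ z : Module.End ℂ V, (∀ k, k ≠ j → ∀ Y ∈ 𝒜 k, Y * z = z * Y) →
      ∀ Y ∈ Algebra.adjoin ℂ G, z * Y = Y * z := by
    intro z hz Y hY
    induction hY using Algebra.adjoin_induction with
    | mem t ht =>
      obtain ⟨k, hk, ht⟩ := ht
      exact (hz k hk t ht).symm
    | algebraMap c => exact (Algebra.commutes c z).symm
    | add t u _ _ h1 h2 => rw [add_mul, mul_add, h1, h2]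
    | mul t u _ _ h1 h2 => rw [← mul_assoc, h1, mul_assoc, h2, mul_assoc]
  refine mem_of_commute_of_adjoin_eq_top (𝒜 j) (Algebra.adjoin ℂ G)
    (fun a ha => hcent a fun k hk Y hY => hcomm k j hk Y hY a ha) ?_ ?_ (hcent C hC)
  · rw [eq_top_iff, ← hgen]
    refine Algebra.adjoin_le (Set.iUnion_subset fun k Y hY => ?_)
    by_cases hk : k = j
    · subst hk
      exact Algebra.subset_adjoin (Or.inl hY)
    · exact Algebra.subset_adjoin (Or.inr (Algebra.subset_adjoin ⟨k, hk, hY⟩))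
  · intro Y hY
    induction hY using Algebra.adjoin_induction with
    | mem t ht =>
      obtain ⟨k, hk, ht⟩ := ht
      obtain ⟨Z, hZ, h⟩ := hstar k t ht
      exact ⟨Z, Algebra.subset_adjoin ⟨k, hk, hZ⟩, h⟩
    | algebraMap c =>
      refine ⟨algebraMap ℂ _ (star c), Subalgebra.algebraMap_mem _ _, fun v w => ?_⟩
      rw [Module.algebraMap_end_apply, Module.algebraMap_end_apply, inner_smul_left,
        inner_smul_right, starRingEnd_apply, star_star]
    | add t u _ _ h1 h2 =>
      obtain ⟨Z, hZ, h⟩ := h1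
      obtain ⟨Z', hZ', h'⟩ := h2
      refine ⟨Z + Z', add_mem hZ hZ', fun v w => ?_⟩
      rw [LinearMap.add_apply, LinearMap.add_apply, inner_add_left, inner_add_right, h, h']
    | mul t u _ _ h1 h2 =>
      obtain ⟨Z, hZ, h⟩ := h1
      obtain ⟨Z', hZ', h'⟩ := h2
      refine ⟨Z' * Z, mul_mem hZ' hZ, fun v w => ?_⟩
      rw [Module.End.mul_apply, Module.End.mul_apply, h', h]

/-- The product `∏ j, a j` of operators from commuting algebras. -/
def algProd (hcomm : ∀ j k, j ≠ k → ∀ X ∈ 𝒜 j, ∀ Y ∈ 𝒜 k, X * Y = Y * X) :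
    (∀ j, 𝒜 j) →* Module.End ℂ V :=
  MonoidHom.noncommPiCoprod (fun j => ((𝒜 j).val : 𝒜 j →* Module.End ℂ V))
    fun j k hjk X Y => hcomm j k hjk X X.2 Y Y.2

variable {hcomm : ∀ j k, j ≠ k → ∀ X ∈ 𝒜 j, ∀ Y ∈ 𝒜 k, X * Y = Y * X}

theorem algProd_mulSingle (j : Fin K) (X : 𝒜 j) : algProd hcomm (Pi.mulSingle j X) = X :=
  MonoidHom.noncommPiCoprod_mulSingle (N := fun j => 𝒜 j)
    (fun j => ((𝒜 j).val : 𝒜 j →* Module.End ℂ V)) j X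

theorem algProd_update (a : ∀ j, 𝒜 j) (j : Fin K) (X : 𝒜 j) :
    algProd hcomm (Function.update a j X) =
      X * algProd hcomm (Function.update a j 1) := by
  rw [← algProd_mulSingle (hcomm := hcomm) j X, ← map_mul]
  congr 1
  funext k
  by_cases hk : k = j
  · subst hk; simp
  · simp [hk]

theorem algProd_update' (a : ∀ j, 𝒜 j) (j : Fin K) (X : 𝒜 j) :
    algProd hcomm (Function.update a j X) =
      algProd hcomm (Function.update a j 1) * X := by
  rw [← algProd_mulSingle (hcomm := hcomm) j X, ← map_mul]
  congr 1
  funext k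
  by_cases hk : k = j
  · subst hk; simp
  · simp [hk]

theorem algProd_update_one_mul (a : ∀ j, 𝒜 j) (j : Fin K) (X : 𝒜 j) :
    algProd hcomm (Function.update a j 1) * X = X * algProd hcomm (Function.update a j 1) := by
  rw [← algProd_update, ← algProd_update']

variable {P : Fin K → Module.End ℂ V} {ψ : V}

/-- The vector `P j (Y ψ)` is fixed by `P j` since this is idempotent, and by every other `P k`
since that commutes with `P j * Y` and fixes `ψ`. Uniqueness makes it a multiple of `ψ`. -/
theorem projection_apply_eq_inner_smul (hψ : ‖ψ‖ = 1)
    (hP : ∀ j, P j ∈ 𝒜 j) (hPP : ∀ j, P j * P j = P j) (hPψ : ∀ j, P j ψ = ψ)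
    (hPs : ∀ j v w, inner ℂ (P j v) w = inner ℂ v (P j w))
    (hcomm : ∀ j k, j ≠ k → ∀ X ∈ 𝒜 j, ∀ Y ∈ 𝒜 k, X * Y = Y * X)
    (huniq : ∀ u, (∀ j, P j u = u) → ∃ c : ℂ, u = c • ψ) {j : Fin K} {Y : Module.End ℂ V}
    (hY : Y ∈ 𝒜 j) : P j (Y ψ) = inner ℂ ψ (Y ψ) • ψ := by
  obtain ⟨c, hc⟩ := huniq (P j (Y ψ)) fun k => by
    by_cases hk : k = j
    · subst hk
      rw [← Module.End.mul_apply, hPP]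
    · rw [← Module.End.mul_apply (P j), ← Module.End.mul_apply,
        hcomm k j hk _ (hP k) _ (mul_mem (hP j) hY), Module.End.mul_apply, hPψ,
        Module.End.mul_apply]
  have : inner ℂ ψ (P j (Y ψ)) = c := by
    rw [hc, inner_smul_right, inner_self_eq_norm_sq_to_K, hψ]; simp
  rw [hc, ← this, ← hPs, hPψ]

/-- One factor is split off at a time. With `α`, `β` the products of the remaining factors and `Z`
the adjoint of `a i`, the inner product is `⟨αψ, Z b_i βψ⟩`. Since `αψ = P_i αψ`, it equals `⟨αψ, β
P_i Z b_i ψ⟩`, and `P_i Z b_i ψ` is `⟨ψ, Z b_i ψ⟩ ψ`. -/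
theorem inner_algProd_apply (hψ : ‖ψ‖ = 1)
    (hstar : ∀ j, ∀ Y ∈ 𝒜 j, ∃ Z ∈ 𝒜 j, ∀ v w, inner ℂ (Z v) w = inner ℂ v (Y w))
    (hP : ∀ j, P j ∈ 𝒜 j) (hPP : ∀ j, P j * P j = P j) (hPψ : ∀ j, P j ψ = ψ)
    (hPs : ∀ j v w, inner ℂ (P j v) w = inner ℂ v (P j w))
    (huniq : ∀ u, (∀ j, P j u = u) → ∃ c : ℂ, u = c • ψ) (a b : ∀ j, 𝒜 j) :
    inner ℂ (algProd hcomm a ψ) (algProd hcomm b ψ) =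
      ∏ j, inner ℂ ((a j : Module.End ℂ V) ψ) ((b j : Module.End ℂ V) ψ) := by
  -- `s` holds the indices already split off; their factors are replaced by `1` in what remains.
  have key : ∀ s : Finset (Fin K), inner ℂ (algProd hcomm a ψ) (algProd hcomm b ψ) =
      (∏ j ∈ s, inner ℂ ((a j : Module.End ℂ V) ψ) ((b j : Module.End ℂ V) ψ)) *
      inner ℂ (algProd hcomm (s.piecewise 1 a) ψ) (algProd hcomm (s.piecewise 1 b) ψ) := by
    intro s
    induction s using Finset.induction with
    | empty => simp
    | insert i s hi ih =>
      rw [ih, Finset.prod_insert hi, mul_comm (inner ℂ _ _) (∏ _ ∈ s, _), mul_assoc]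
      congr 1
      rw [Finset.piecewise_insert, Finset.piecewise_insert, Pi.one_apply]
      have ha : algProd hcomm (s.piecewise 1 a) =
          algProd hcomm (Function.update (s.piecewise 1 a) i 1) * (a i : Module.End ℂ V) := by
        rw [← algProd_update', ← Finset.piecewise_eq_of_notMem s (1 : ∀ j, 𝒜 j) a hi,
          Function.update_eq_self]
      have hb : algProd hcomm (s.piecewise 1 b) =
          algProd hcomm (Function.update (s.piecewise 1 b) i 1) * (b i : Module.End ℂ V) := by
        rw [← algProd_update', ← Finset.piecewise_eq_of_notMem s (1 : ∀ j, 𝒜 j) b hi,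
          Function.update_eq_self]
      rw [ha, hb]
      obtain ⟨Z, hZ, h⟩ := hstar i (a i) (a i).2
      set α := algProd hcomm (Function.update (s.piecewise 1 a) i 1)
      set β := algProd hcomm (Function.update (s.piecewise 1 b) i 1)
      have hα : ∀ X : 𝒜 i, α * (X : Module.End ℂ V) = X * α := algProd_update_one_mul _ i
      have hβ : ∀ X : 𝒜 i, β * (X : Module.End ℂ V) = X * β := algProd_update_one_mul _ i
      have hPα : P i (α ψ) = α ψ := by
        rw [← Module.End.mul_apply, ← hα ⟨P i, hP i⟩, Module.End.mul_apply, hPψ]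
      rw [hα, hβ, Module.End.mul_apply, Module.End.mul_apply]
      have h' : ∀ v w, inner ℂ ((a i : Module.End ℂ V) v) w = inner ℂ v (Z w) := by
        intro v w
        rw [← inner_conj_symm, ← h, inner_conj_symm]
      rw [h', h', ← hPα, hPs, ← Module.End.mul_apply Z, ← Module.End.mul_apply (P i),
        ← Module.End.mul_apply _ β, ← hβ ⟨P i * (Z * b i), mul_mem (hP i) (mul_mem hZ (b i).2)⟩,
        Module.End.mul_apply β, Module.End.mul_apply (P i),
        projection_apply_eq_inner_smul hψ hP hPP hPψ hPs hcomm huniq (mul_mem hZ (b i).2),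
        map_smul, inner_smul_right, hPα, Module.End.mul_apply]
  rw [key Finset.univ, Finset.piecewise_univ, Finset.piecewise_univ, map_one, Module.End.one_apply,
    inner_self_eq_norm_sq_to_K, hψ]
  simp

/-- Commuting self-adjoint algebras that generate all operators, with a vector that is the only
joint fixed vector of projections from the algebras, induce a tensor factorization. -/
theorem exists_factorization (hψ : ‖ψ‖ = 1)
    (hcomm : ∀ j k, j ≠ k → ∀ X ∈ 𝒜 j, ∀ Y ∈ 𝒜 k, X * Y = Y * X)
    (hgen : Algebra.adjoin ℂ (⋃ j, (𝒜 j : Set (Module.End ℂ V))) = ⊤)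
    (hstar : ∀ j, ∀ Y ∈ 𝒜 j, ∃ Z ∈ 𝒜 j, ∀ v w, inner ℂ (Z v) w = inner ℂ v (Y w))
    (hP : ∀ j, P j ∈ 𝒜 j) (hPP : ∀ j, P j * P j = P j) (hPψ : ∀ j, P j ψ = ψ)
    (hPs : ∀ j v w, inner ℂ (P j v) w = inner ℂ v (P j w))
    (huniq : ∀ u, (∀ j, P j u = u) → ∃ c : ℂ, u = c • ψ) :
    ∃ (m : Fin K → ℕ) (W : V ≃ₗᵢ[ℂ] Hilb (Cfg m)), ∀ j Y, Y ∈ 𝒜 j ↔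
      ∃ B : Op (Fin (m j)), ∀ v, W (Y v) = act (ampliate (single m j) B) (W v) := by
  classical
  have hinner := inner_algProd_apply (hcomm := hcomm) hψ hstar hP hPP hPψ hPs huniq
  -- The `j`-th tensor factor is the orbit `𝒜_j ψ`.
  let M : Fin K → Submodule ℂ V := fun j =>
    (Subalgebra.toSubmodule (𝒜 j)).map (LinearMap.applyₗ ψ)
  have hM : ∀ j (X : 𝒜 j), (X : Module.End ℂ V) ψ ∈ M j := fun j X => ⟨X, X.2, rfl⟩
  let m : Fin K → ℕ := fun j => Module.finrank ℂ (M j)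
  let u : ∀ j, OrthonormalBasis (Fin (m j)) ℂ (M j) := fun j => stdOrthonormalBasis ℂ (M j)
  have hA : ∀ j (x : Fin (m j)), ∃ X : 𝒜 j, (X : Module.End ℂ V) ψ = u j x := by
    intro j x
    obtain ⟨X, hX, h⟩ := (u j x).2
    exact ⟨⟨X, hX⟩, h⟩
  choose A hA using hA
  have hexp : ∀ j (X : 𝒜 j), ∃ c : Fin (m j) → ℂ,
      (X : Module.End ℂ V) ψ = ∑ x, c x • (A j x : Module.End ℂ V) ψ := by
    intro j X
    refine ⟨fun x => (u j).repr ⟨_, hM j X⟩ x, ?_⟩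
    have := congrArg Subtype.val ((u j).sum_repr ⟨_, hM j X⟩)
    simp only [AddSubmonoidClass.coe_finsetSum, Submodule.coe_smul] at this
    simp only [hA, this]
  let w : Cfg m → V := fun x => algProd hcomm (fun j => A j (x j)) ψ
  have hw : Orthonormal ℂ w := by
    rw [orthonormal_iff_ite]
    intro x y
    simp only [w, hinner, hA, ← Submodule.coe_inner]
    simp only [orthonormal_iff_ite.1 (u _).orthonormal, Finset.prod_ite_zero, funext_iff]
    simp
  have hspan : ∀ a : ∀ j, 𝒜 j, algProd hcomm a ψ ∈ Submodule.span ℂ (Set.range w) := by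
    have key : ∀ s : Finset (Fin K), ∀ a : ∀ j, 𝒜 j, (∀ j, j ∉ s → ∃ x, a j = A j x) →
        algProd hcomm a ψ ∈ Submodule.span ℂ (Set.range w) := by
      intro s
      induction s using Finset.induction with
      | empty =>
        intro a ha
        choose x hx using fun j => ha j (Finset.notMem_empty j)
        refine Submodule.subset_span ⟨x, ?_⟩
        simp only [w, ← hx]
      | insert i s _ ih =>
        intro a ha
        obtain ⟨c, hc⟩ := hexp i (a i)
        rw [← Function.update_eq_self i a, algProd_update', Module.End.mul_apply, hc, map_sum]
        refine Submodule.sum_mem _ fun x _ => ?_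
        rw [map_smul, ← Module.End.mul_apply, ← algProd_update']
        refine Submodule.smul_mem _ _ (ih _ fun j hj => ?_)
        by_cases hji : j = i
        · subst hji
          exact ⟨x, Function.update_self ..⟩
        · rw [Function.update_of_ne hji]
          exact ha j fun h => (Finset.mem_insert.1 h).elim hji hj
    exact fun a => key Finset.univ a fun j hj => absurd (Finset.mem_univ j) hj
  have htop : ⊤ ≤ Submodule.span ℂ (Set.range w) := by
    -- The span of the vectors `algProd hcomm a ψ` is invariant under generators, hence under every
    -- operator; the rank-one operator `|v⟩⟨ψ|` then carries `ψ` to an arbitrary `v`.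
    have hinv : ∀ T : Module.End ℂ V,
        ∀ v ∈ Submodule.span ℂ (Set.range fun a => algProd hcomm a ψ),
          T v ∈ Submodule.span ℂ (Set.range fun a => algProd hcomm a ψ) := by
      intro T
      have hT : T ∈ Algebra.adjoin ℂ (⋃ j, (𝒜 j : Set (Module.End ℂ V))) := hgen ▸ trivial
      induction hT using Algebra.adjoin_induction with
      | mem T hT =>
        obtain ⟨j, hj⟩ := Set.mem_iUnion.1 hT
        intro v hv
        have := Submodule.mem_map_of_mem (f := T) hv
        rw [Submodule.map_span] at this
        refine Submodule.span_mono ?_ this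
        rintro _ ⟨_, ⟨a, rfl⟩, rfl⟩
        refine ⟨Pi.mulSingle j ⟨T, hj⟩ * a, ?_⟩
        simp only [map_mul, algProd_mulSingle, Module.End.mul_apply]
      | algebraMap c => exact fun v hv => Submodule.smul_mem _ c hv
      | add T U _ _ h1 h2 => exact fun v hv => add_mem (h1 v hv) (h2 v hv)
      | mul T U _ _ h1 h2 => exact fun v hv => h1 _ (h2 v hv)
    intro v _
    have h1 := hinv ((innerSL ℂ ψ : V →ₗ[ℂ] ℂ).smulRight v) ψ
      (Submodule.subset_span ⟨1, by simp⟩)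
    have h2 : (innerSL ℂ ψ : V →ₗ[ℂ] ℂ).smulRight v ψ = v := by
      simp [inner_self_eq_norm_sq_to_K, hψ]
    rw [h2] at h1
    refine Submodule.span_le.2 ?_ h1
    rintro _ ⟨a, rfl⟩
    exact hspan a
  let b := OrthonormalBasis.mk hw htop
  have hb : ∀ x, b x = w x := fun x => by simp [b]
  have hbw : ∀ x, b.repr (w x) = EuclideanSpace.single x 1 := fun x => by
    rw [← hb, OrthonormalBasis.repr_self]
  -- `Y` passes the factors of other index, and `Y (A j x ψ)` stays in `𝒜_j ψ`; so `Y` changes only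
  -- the `j`-th index of the basis `w`.
  have hmp : ∀ j, ∀ Y ∈ 𝒜 j,
      ∃ B : Op (Fin (m j)), ∀ v, b.repr (Y v) = act (ampliate (single m j) B) (b.repr v) := by
    intro j Y hY
    choose B hB using fun x : Fin (m j) => hexp j (⟨Y, hY⟩ * A j x)
    refine ⟨Matrix.of fun y x => B x y, fun v => ?_⟩
    have hlin : (b.repr.toLinearEquiv : V →ₗ[ℂ] _) ∘ₗ Y =
        act (ampliate (single m j) (Matrix.of fun y x => B x y)) ∘ₗ
          (b.repr.toLinearEquiv : V →ₗ[ℂ] _) := by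
      refine b.toBasis.ext fun x => ?_
      have hYw : Y (w x) = ∑ y, B (x j) y • w (Function.update x j y) := by
        have hupd : ∀ y, w (Function.update x j y) =
            algProd hcomm (Function.update (fun j => A j (x j)) j 1)
              ((A j y : Module.End ℂ V) ψ) := by
          intro y
          rw [← Module.End.mul_apply, ← algProd_update']
          simp only [w]
          congr 2
          funext k
          by_cases hk : k = j
          · subst hk; simp
          · simp [hk]
        have hx := hupd (x j)
        rw [Function.update_eq_self] at hx
        rw [hx, ← Module.End.mul_apply, ← algProd_update_one_mul _ j ⟨Y, hY⟩, Module.End.mul_apply,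
          ← Module.End.mul_apply Y]
        have := hB (x j)
        rw [Subalgebra.coe_mul] at this
        rw [this, map_sum]
        simp only [map_smul, ← hupd]
      simp only [LinearMap.comp_apply, OrthonormalBasis.coe_toBasis, hb, LinearEquiv.coe_coe,
        LinearIsometryEquiv.coe_toLinearEquiv, hYw, map_sum, map_smul, hbw]
      rw [← prodVec_single_one, act_ampliate_single_prodVec]
      have : act (Matrix.of fun y x => B x y) (EuclideanSpace.single (x j) (1 : ℂ)) =
          ∑ y, B (x j) y • EuclideanSpace.single y (1 : ℂ) := by
        ext z
        rw [act_apply]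
        simp [Pi.single_apply]
      ext z
      rw [this, prodVec_apply, ← Finset.mul_prod_erase _ _ (Finset.mem_univ j),
        Function.update_self]
      have hprod : ∀ y, (EuclideanSpace.single (Function.update x j y) (1 : ℂ) : Hilb (Cfg m)) z =
          (EuclideanSpace.single y (1 : ℂ) : Hilb (Fin (m j))) (z j) *
            ∏ k ∈ Finset.univ.erase j,
              (Function.update (fun i => EuclideanSpace.single (x i) (1 : ℂ)) j
                (∑ y, B (x j) y • EuclideanSpace.single y (1 : ℂ)) k) (z k) := by
        intro y
        rw [← prodVec_single_one, prodVec_apply, ← Finset.mul_prod_erase _ _ (Finset.mem_univ j),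
          Function.update_self]
        congr 1
        refine Finset.prod_congr rfl fun k hk => ?_
        rw [Function.update_of_ne (Finset.ne_of_mem_erase hk),
          Function.update_of_ne (Finset.ne_of_mem_erase hk)]
      simp only [WithLp.ofLp_sum, WithLp.ofLp_smul, Finset.sum_apply, Pi.smul_apply, smul_eq_mul,
        Finset.sum_mul, hprod, mul_assoc]
    exact LinearMap.congr_fun hlin v
  refine ⟨m, b.repr, fun j Y => ⟨hmp j Y, ?_⟩⟩
  -- An operator on the `j`-th factor commutes with operators on the other factors, hence with all
  -- `𝒜 k`, `k ≠ j`; the commutant result applies.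
  rintro ⟨B, hB⟩
  refine mem_of_commute_others hcomm hgen hstar fun k hk Z hZ => ?_
  obtain ⟨B', hB'⟩ := hmp k Z hZ
  ext1 v
  apply b.repr.injective
  rw [Module.End.mul_apply, Module.End.mul_apply, hB', hB, hB, hB', ← act_mul, ← act_mul,
    ampliate_single_commute hk]

end Factorization

/-! ### Kraus maps -/

section Kraus

variable {n α : Type} [Fintype n] [DecidableEq n] [Fintype α]

/-- The map `M ↦ ∑ a, K a * M * (K a)ᴴ`. -/
def krausMap (K : α → Op n) : Op n →ₗ[ℂ] Op n where
  toFun M := ∑ a, K a * M * (K a)ᴴ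
  map_add' _ _ := by simp [mul_add, add_mul, Finset.sum_add_distrib]
  map_smul' _ _ := by simp [Finset.smul_sum]

theorem krausMap_apply (K : α → Op n) (M : Op n) : krausMap K M = ∑ a, K a * M * (K a)ᴴ := rfl

theorem isCPTP_krausMap {K : α → Op n} (hK : ∑ a, (K a)ᴴ * K a = 1) : IsCPTP (krausMap K) := by
  let e := Fintype.equivFin α
  refine ⟨Fintype.card α, fun i => K (e.symm i), ?_, fun M => ?_⟩
  · rw [← hK]
    exact Equiv.sum_comp e.symm fun a => (K a)ᴴ * K a
  · exact (Equiv.sum_comp e.symm fun a => K a * M * (K a)ᴴ).symm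

theorem act_ketbra (ψ v : Hilb n) : act (ketbra ψ) v = inner ℂ ψ v • ψ := by
  ext a
  rw [act_apply]
  simp only [ketbra, Matrix.of_apply, WithLp.ofLp_smul, Pi.smul_apply, smul_eq_mul,
    PiLp.inner_apply, RCLike.inner_apply, Finset.sum_mul, starRingEnd_apply]
  exact Finset.sum_congr rfl fun b _ => by ring

theorem mul_ketbra_mul_conjTranspose (X : Op n) (ψ : Hilb n) :
    X * ketbra ψ * Xᴴ = ketbra (act X ψ) :=
  op_ext fun v => by
    rw [act_mul, act_mul, act_ketbra, act_ketbra, map_smul, inner_act_left]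

theorem krausMap_ketbra (K : α → Op n) (ψ : Hilb n) :
    krausMap K (ketbra ψ) = ∑ a, ketbra (act (K a) ψ) := by
  simp only [krausMap_apply, mul_ketbra_mul_conjTranspose]

/-- Each Kraus operator contributes `|c_a|²` times `|φ⟩⟨φ|`, and trace preservation makes these
weights sum to one when `φ ≠ 0`. -/
theorem krausMap_ketbra_eq_self {K : α → Op n} (hK : ∑ a, (K a)ᴴ * K a = 1) {φ : Hilb n}
    {c : α → ℂ} (h : ∀ a, act (K a) φ = c a • φ) : krausMap K (ketbra φ) = ketbra φ := by
  refine op_ext fun v => ?_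
  rw [krausMap_ketbra, act_sum_op]
  simp only [act_ketbra, h, inner_smul_left, smul_smul]
  rw [← Finset.sum_smul]
  rcases eq_or_ne φ 0 with rfl | hφ
  · simp
  congr 1
  have h1 : ∑ a, starRingEnd ℂ (c a) * c a * inner ℂ φ φ = 1 * inner ℂ φ φ := by
    have := congrArg (fun X => inner ℂ φ (act X φ)) hK
    simp only [act_sum_op, act_one, act_mul, inner_sum] at this
    rw [one_mul]
    refine (Finset.sum_congr rfl fun a _ => ?_).trans this
    rw [← inner_act_left, h, inner_smul_left, inner_smul_right, mul_assoc]
  rw [← Finset.sum_mul] at h1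
  have h2 := mul_right_cancel₀ (inner_self_ne_zero.2 hφ) h1
  calc ∑ a, starRingEnd ℂ (c a) * inner ℂ φ v * c a
      = (∑ a, starRingEnd ℂ (c a) * c a) * inner ℂ φ v := by
        rw [Finset.sum_mul]; exact Finset.sum_congr rfl fun a _ => by ring
    _ = inner ℂ φ v := by rw [h2, one_mul]

/-- A pure state is extremal. Explicitly, for the component `v` of `K a ψ` orthogonal to `ψ`,
invariance gives `∑ b, |⟨K b ψ, v⟩|² = |⟨ψ, v⟩|² = 0`, so `v` is orthogonal to `K a ψ` and to
itself. -/
theorem exists_smul_of_krausMap_ketbra_eq_self {K : α → Op n} {ψ : Hilb n} (hψ : ‖ψ‖ = 1)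
    (h : krausMap K (ketbra ψ) = ketbra ψ) (a : α) : ∃ c : ℂ, act (K a) ψ = c • ψ := by
  refine ⟨inner ℂ ψ (act (K a) ψ), ?_⟩
  set v := act (K a) ψ - inner ℂ ψ (act (K a) ψ) • ψ with hv
  have hψψ : inner ℂ ψ ψ = (1 : ℂ) := by rw [inner_self_eq_norm_sq_to_K, hψ]; simp
  have hvψ : inner ℂ ψ v = (0 : ℂ) := by
    rw [hv, inner_sub_right, inner_smul_right, hψψ, mul_one, sub_self]
  have h1 : ∑ b, ((‖inner ℂ (act (K b) ψ) v‖ ^ 2 : ℝ) : ℂ) = 0 := by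
    have := congrArg (fun X => inner ℂ v (act X v)) h
    simp only [krausMap_ketbra, act_sum_op, act_ketbra, inner_sum, inner_smul_right, hvψ,
      zero_mul] at this
    rw [← this]
    refine Finset.sum_congr rfl fun b _ => ?_
    rw [← inner_conj_symm v, RCLike.mul_conj]
    norm_cast
  have h2 : ∑ b, ‖inner ℂ (act (K b) ψ) v‖ ^ 2 = 0 := by exact_mod_cast h1
  have h3 := (Finset.sum_eq_zero_iff_of_nonneg fun b _ => sq_nonneg _).1 h2 a (Finset.mem_univ a)
  have h4 := norm_eq_zero.1 ((pow_eq_zero_iff two_ne_zero).1 h3)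
  have h5 : inner ℂ v v = (0 : ℂ) := by
    nth_rw 1 [hv]
    rw [inner_sub_left, h4, inner_smul_left, hvψ, mul_zero, sub_zero]
  exact sub_eq_zero.1 (inner_self_eq_zero.1 h5)

theorem isDensity_ketbra {ψ : Hilb n} (hψ : ‖ψ‖ = 1) : IsDensity (ketbra ψ) := by
  have h : ketbra ψ = Matrix.vecMulVec (ψ : n → ℂ) (star (ψ : n → ℂ)) := rfl
  refine ⟨h ▸ Matrix.posSemidef_vecMulVec_self_star _, ?_⟩
  have h2 := EuclideanSpace.norm_sq_eq ψ
  rw [hψ] at h2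
  have h3 : (ketbra ψ).trace = ((∑ i, ‖ψ i‖ ^ 2 : ℝ) : ℂ) := by
    simp only [Matrix.trace, Matrix.diag, ketbra, Matrix.of_apply, Complex.ofReal_sum]
    refine Finset.sum_congr rfl fun i _ => ?_
    rw [Complex.star_def, Complex.mul_conj, Complex.normSq_eq_norm_sq]
  rw [h3, ← h2]
  simp

theorem IsDensity.krausMap {K : α → Op n} (hK : ∑ a, (K a)ᴴ * K a = 1) {σ : Op n}
    (hσ : IsDensity σ) : IsDensity (krausMap K σ) := by
  refine ⟨Matrix.posSemidef_sum _ fun a _ => hσ.1.mul_mul_conjTranspose_same _, ?_⟩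
  rw [krausMap_apply, Matrix.trace_sum, ← hσ.2]
  calc ∑ a, (K a * σ * (K a)ᴴ).trace = ∑ a, ((K a)ᴴ * K a * σ).trace := by
        refine Finset.sum_congr rfl fun a _ => ?_
        rw [Matrix.trace_mul_comm, ← mul_assoc]
    _ = σ.trace := by rw [← Matrix.trace_sum, ← Finset.sum_mul, hK, one_mul]

theorem act_krausMap_mem {K : α → Op n} {L L' : Submodule ℂ (Hilb n)}
    (hK : ∀ a, ∀ u ∈ L, act (K a) u ∈ L') {M : Op n} (hM : ∀ v, act M v ∈ L) (v : Hilb n) :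
    act (krausMap K M) v ∈ L' := by
  rw [krausMap_apply, act_sum_op]
  refine Submodule.sum_mem _ fun a _ => ?_
  rw [act_mul, act_mul]
  exact hK a _ (hM _)

theorem eq_ketbra_of_range {ψ : Hilb n} (hψ : ‖ψ‖ = 1) {σ : Op n} (hσ : IsDensity σ)
    (h : ∀ v, ∃ c : ℂ, act σ v = c • ψ) : σ = ketbra ψ := by
  have hψψ : inner ℂ ψ ψ = (1 : ℂ) := by rw [inner_self_eq_norm_sq_to_K, hψ]; simp
  have h1 : ∀ v, act σ v = inner ℂ ψ (act σ v) • ψ := by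
    intro v
    obtain ⟨c, hc⟩ := h v
    rw [hc, inner_smul_right, hψψ, mul_one]
  obtain ⟨c, hc⟩ := h ψ
  have h2 : σ = starRingEnd ℂ c • ketbra ψ := op_ext fun v => by
    rw [h1, act_smul_op, act_ketbra, inner_act_right, hσ.1.isHermitian.eq, hc, inner_smul_left,
      smul_smul]
  have h3 := hσ.2
  rw [h2, Matrix.trace_smul, (isDensity_ketbra hψ).2, smul_eq_mul, mul_one] at h3
  rw [h2, h3, one_smul]

end Kraus

/-! ### Neighborhood maps and the uniqueness of the jointly fixed vector -/

section NeighborhoodMaps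

theorem isTensorId_krausMap {A B C α : Type} [Fintype A] [Fintype B] [Fintype C] [Fintype α]
    [DecidableEq A] [DecidableEq B] [DecidableEq C] (e : C ≃ A × B) (K : α → Op A) :
    IsTensorId e (krausMap fun a => ampliate e (K a)) (krausMap K) := by
  intro M a a' b b'
  simp only [krausMap_apply, Matrix.sum_apply]
  refine Finset.sum_congr rfl fun i _ => ?_
  rw [ampliate_conjTranspose, Matrix.mul_apply, Matrix.mul_apply, ← Equiv.sum_comp e.symm,
    Fintype.sum_prod_type]
  refine Finset.sum_congr rfl fun x _ => ?_
  simp only [ampliate_apply, Equiv.apply_symm_apply, mul_ite, mul_one, mul_zero,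
    Finset.sum_ite_eq', Finset.mem_univ, if_true]
  congr 1
  rw [Matrix.mul_apply, Matrix.mul_apply, ← Equiv.sum_comp e.symm, Fintype.sum_prod_type]
  simp [ampliate_apply]

theorem IsTensorId.eq {A B C : Type} {e : C ≃ A × B} {E E' : Op C →ₗ[ℂ] Op C}
    {F F' : Op A →ₗ[ℂ] Op A} (h : IsTensorId e E F) (h' : IsTensorId e E' F') (hF : F = F') :
    E = E' := by
  subst hF
  ext M x y
  have h1 := h M (e x).1 (e y).1 (e x).2 (e y).2
  rw [← h' M (e x).1 (e y).1 (e x).2 (e y).2] at h1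
  simpa using h1

variable {N K : ℕ} {d : Fin N → ℕ} {nbhd : Fin K → Finset (Fin N)} {ψ : Hilb (Cfg d)}

theorem IsNeighborhoodMap.exists_kraus {S : Finset (Fin N)} {E : Op (Cfg d) →ₗ[ℂ] Op (Cfg d)}
    (hE : IsNeighborhoodMap d S E) : ∃ (r : ℕ) (X : Fin r → Op (SubCfg d S)),
      ∑ a, (X a)ᴴ * X a = 1 ∧ E = krausMap fun a => ampliate (split d S) (X a) := by
  obtain ⟨F, ⟨r, X, hX, hF⟩, hEF⟩ := hE
  exact ⟨r, X, hX, hEF.eq (isTensorId_krausMap _ X) (LinearMap.ext hF)⟩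

theorem isNeighborhoodMap_krausMap {α : Type} [Fintype α] {S : Finset (Fin N)}
    {X : α → Op (SubCfg d S)} (hX : ∑ a, (X a)ᴴ * X a = 1) :
    IsNeighborhoodMap d S (krausMap fun a => ampliate (split d S) (X a)) :=
  ⟨krausMap X, isCPTP_krausMap hX, isTensorId_krausMap _ X⟩

theorem sum_ampliate_conjTranspose_mul {A B C α : Type} [Fintype A] [Fintype B] [Fintype C]
    [Fintype α] [DecidableEq A] [DecidableEq B] [DecidableEq C] (e : C ≃ A × B) {X : α → Op A}
    (hX : ∑ a, (X a)ᴴ * X a = 1) : ∑ a, (ampliate e (X a))ᴴ * ampliate e (X a) = 1 := by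
  simp only [ampliate_conjTranspose, ← ampliate_mul]
  rw [← ampliate_sum, hX, ampliate_one]

theorem IsNeighborhoodMap.isDensity {S : Finset (Fin N)} {E : Op (Cfg d) →ₗ[ℂ] Op (Cfg d)}
    (hE : IsNeighborhoodMap d S E) {σ : Op (Cfg d)} (hσ : IsDensity σ) : IsDensity (E σ) := by
  obtain ⟨r, X, hX, rfl⟩ := hE.exists_kraus
  exact hσ.krausMap (sum_ampliate_conjTranspose_mul _ hX)

/-- Invariance of `ψ` makes it an eigenvector of each `X a ⊗ 𝕀`. Slicing this equation shows that `X
a` is the scalar `c a` on the Schmidt span, so `u` is an eigenvector with the same eigenvalues. -/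
theorem IsNeighborhoodMap.map_ketbra_eq_self (hψ : ‖ψ‖ = 1) {S : Finset (Fin N)}
    {E : Op (Cfg d) →ₗ[ℂ] Op (Cfg d)} (hE : IsNeighborhoodMap d S E)
    (hEψ : E (ketbra ψ) = ketbra ψ) {u : Hilb (Cfg d)} (hu : act (schmidtProj d ψ S) u = u) :
    E (ketbra u) = ketbra u := by
  obtain ⟨r, X, hX, rfl⟩ := hE.exists_kraus
  choose c hc using exists_smul_of_krausMap_ketbra_eq_self hψ hEψ
  refine krausMap_ketbra_eq_self (sum_ampliate_conjTranspose_mul _ hX) (c := c) fun a => ?_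
  refine slice_ext (split d S) fun b => ?_
  rw [slice_act_ampliate, slice_smul]
  have hspan : ∀ w ∈ schmidtSpan (split d S) ψ, act (X a) w = c a • w := by
    intro w hw
    induction hw using Submodule.span_induction with
    | mem w hw =>
      obtain ⟨b, rfl⟩ := hw
      rw [← slice_act_ampliate, hc, slice_smul]
    | zero => simp
    | add v w _ _ h1 h2 => rw [map_add, h1, h2, smul_add]
    | smul z w _ h => rw [map_smul, h, smul_comm]
  exact hspan _ ((act_ampliate_eq_self_iff _).1 hu b)

theorem applyMaps_eq_self {n : Type} {L : List (Op n →ₗ[ℂ] Op n)} {σ : Op n}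
    (h : ∀ E ∈ L, E σ = σ) : applyMaps L σ = σ := by
  induction L with
  | nil => rfl
  | cons E L ih =>
    rw [applyMaps, List.foldl_cons, h E List.mem_cons_self]
    exact ih fun E' hE' => h E' (List.mem_cons_of_mem _ hE')

/-- A quasi-locally stabilizable pure state is the only state in all extended Schmidt spans. -/
theorem IsQLS.eq_smul (hψ : ‖ψ‖ = 1) (h : IsQLS d nbhd (ketbra ψ)) {u : Hilb (Cfg d)}
    (hu : ∀ k, act (schmidtProj d ψ (nbhd k)) u = u) : ∃ c : ℂ, u = c • ψ := by
  obtain ⟨E, hE, hfix, hlim⟩ := h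
  rcases eq_or_ne u 0 with rfl | hu0
  · exact ⟨0, by simp⟩
  have hnorm : ‖u‖ ≠ 0 := norm_ne_zero_iff.2 hu0
  set w := ((‖u‖ : ℂ)⁻¹) • u with hw
  have hw1 : ‖w‖ = 1 := by
    rw [hw, norm_smul, norm_inv, Complex.norm_real, norm_norm, inv_mul_cancel₀ hnorm]
  have hEw : ∀ t, E t (ketbra w) = ketbra w := by
    intro t
    obtain ⟨k, hk⟩ := hE t
    refine hk.map_ketbra_eq_self hψ (hfix t) ?_
    rw [hw, map_smul, hu]
  have hconst : ∀ k : ℕ,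
      applyMaps ((List.range k).map fun i => E (0 + i)) (ketbra w) = ketbra w := by
    intro k
    refine applyMaps_eq_self fun E' hE' => ?_
    obtain ⟨i, -, rfl⟩ := List.mem_map.1 hE'
    exact hEw _
  have hl := hlim _ (isDensity_ketbra hw1) 0
  simp only [hconst] at hl
  have heq : ketbra w = ketbra ψ := tendsto_nhds_unique tendsto_const_nhds hl
  have h2 := congrArg (fun X => act X w) heq
  simp only [act_ketbra, inner_self_eq_norm_sq_to_K, hw1] at h2
  refine ⟨‖u‖ * inner ℂ ψ w, ?_⟩
  rw [← smul_smul, ← h2, hw]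
  simp [smul_smul, hnorm]

end NeighborhoodMaps

/-! ### Product vectors -/

section ProductVectors

variable {K : ℕ} {m : Fin K → ℕ}

theorem prodVec_smul (c : Fin K → ℂ) (v : ∀ j, Hilb (Fin (m j))) :
    prodVec (fun j => c j • v j) = (∏ j, c j) • prodVec v := by
  ext y
  simp [prodVec_apply, Finset.prod_mul_distrib]

theorem exists_unit_prodVec_eq (hK : 0 < K) {v : ∀ j, Hilb (Fin (m j))} {c : ℂ}
    (h : ‖c • prodVec v‖ = 1) :
    ∃ φ : ∀ j, Hilb (Fin (m j)), (∀ j, ‖φ j‖ = 1) ∧ prodVec φ = c • prodVec v := by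
  -- The scalar is absorbed into the factor of index `0`; this needs at least one factor.
  rw [← prodVec_smul_update ⟨0, hK⟩] at h ⊢
  generalize Function.update v ⟨0, hK⟩ (c • v ⟨0, hK⟩) = w at h ⊢
  rw [norm_prodVec] at h
  have hw : ∀ j, ‖w j‖ ≠ 0 := fun j =>
    (Finset.prod_ne_zero_iff.1 (h ▸ one_ne_zero)) j (Finset.mem_univ j)
  refine ⟨fun j => ((‖w j‖ : ℂ)⁻¹) • w j, fun j => ?_, ?_⟩
  · rw [norm_smul, norm_inv, Complex.norm_real, norm_norm, inv_mul_cancel₀ (hw j)]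
  · rw [prodVec_smul, Finset.prod_inv_distrib, ← Complex.ofReal_prod, h]
    simp

/-- A vector on which, for every factor, some operator of this factor undoes all operators of this
factor up to a scalar is a product vector. -/
theorem exists_prodVec_eq_of_local_projections (hK : 0 < K) {x : Hilb (Cfg m)} (hx : ‖x‖ = 1)
    (h : ∀ j, ∃ P : Op (Fin (m j)), ∀ C : Op (Fin (m j)),
      act (ampliate (single m j) P) (act (ampliate (single m j) C) x) =
        inner ℂ x (act (ampliate (single m j) C) x) • x) :
    ∃ φ : ∀ j, Hilb (Fin (m j)), (∀ j, ‖φ j‖ = 1) ∧ prodVec φ = x := by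
  -- Take `C = |a⟩⟨a|` with nonzero expectation in `x`; one exists because these expectations sum to
  -- one. Only column `a` of `P |a⟩⟨a|` is nonzero, so the hypothesis separates the `j`-th index of
  -- `x` from the others.
  have hfac : ∀ j, ∃ (v : Hilb (Fin (m j))) (a : Fin (m j)),
      ∀ y, x y = v (y j) * x (Function.update y j a) := by
    intro j
    obtain ⟨P, hP⟩ := h j
    obtain ⟨a, ha⟩ : ∃ a, inner ℂ x (act (ampliate (single m j) (Matrix.single a a 1)) x) ≠ 0 := by
      by_contra! h0
      have h1 : ∑ a, inner ℂ x (act (ampliate (single m j) (Matrix.single a a 1)) x) = 1 := by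
        rw [← inner_sum, ← act_sum_op, ← ampliate_sum, Matrix.sum_single_one, ampliate_one,
          act_one, inner_self_eq_norm_sq_to_K, hx]
        simp
      simp [h0] at h1
    refine ⟨WithLp.toLp 2 fun b =>
      (inner ℂ x (act (ampliate (single m j) (Matrix.single a a 1)) x))⁻¹ * P b a, a, fun y => ?_⟩
    have h2 := congrArg (fun w : Hilb (Cfg m) => w y) (hP (Matrix.single a a 1))
    simp only [PiLp.smul_apply, smul_eq_mul] at h2
    rw [← act_mul, ← ampliate_mul, act_ampliate_single] at h2
    have h3 : ∀ b, (P * Matrix.single a a (1 : ℂ)) (y j) b = if b = a then P (y j) a else 0 := by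
      intro b
      by_cases hb : b = a
      · subst hb; simp
      · simp [hb]
    simp only [h3, ite_mul, zero_mul, Finset.sum_ite_eq', Finset.mem_univ,
      if_true] at h2
    rw [PiLp.toLp_apply, mul_assoc, h2, inv_mul_cancel_left₀ ha]
  choose v a hva using hfac
  have key : ∀ s : Finset (Fin K), ∀ y, x y = (∏ j ∈ s, v j (y j)) * x (s.piecewise a y) := by
    intro s
    induction s using Finset.induction with
    | empty => simp
    | insert i s hi ih =>
      intro y
      rw [ih, Finset.prod_insert hi, hva i (s.piecewise a y), Finset.piecewise_insert,
        Finset.piecewise_eq_of_notMem s a y hi]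
      ring
  have hxv : x = x a • prodVec v := by
    ext y
    have h1 := key Finset.univ y
    rw [Finset.piecewise_univ] at h1
    rw [h1, PiLp.smul_apply, smul_eq_mul, prodVec_apply, mul_comm]
  rw [hxv] at hx
  obtain ⟨φ, h1, h2⟩ := exists_unit_prodVec_eq hK hx
  exact ⟨φ, h1, h2.trans hxv.symm⟩

end ProductVectors

/-! ### Factorizations induced by the neighborhood algebras -/

section Induced

variable {N K : ℕ} {d : Fin N → ℕ} {nbhd : Fin K → Finset (Fin N)} {ψ : Hilb (Cfg d)}

theorem IsQLS.pos (h : IsQLS d nbhd (ketbra ψ)) : 0 < K := by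
  obtain ⟨E, hE, -⟩ := h
  obtain ⟨k, -⟩ := hE 0
  exact k.pos

theorem inner_linearIsometryEquiv {V V' : Type} [NormedAddCommGroup V] [InnerProductSpace ℂ V]
    [NormedAddCommGroup V'] [InnerProductSpace ℂ V'] (W : V ≃ₗᵢ[ℂ] V') (v w : V) :
    inner ℂ (W v) (W w) = inner ℂ v w :=
  W.inner_map_map v w

variable (d ψ) in
/-- The vector `ψ`, as an element of its local support. -/
def localVec : localSupport d ψ := ⟨ψ, self_mem_localSupport d ψ⟩

theorem norm_localVec (hψ : ‖ψ‖ = 1) : ‖localVec d ψ‖ = 1 := hψ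

theorem localSchmidtProj_localVec (S : Finset (Fin N)) :
    localSchmidtProj d ψ S (localVec d ψ) = localVec d ψ :=
  Subtype.ext (act_schmidtProj_self S)

theorem IsQLS.eq_smul_localVec (hψ : ‖ψ‖ = 1) (h : IsQLS d nbhd (ketbra ψ))
    (u : localSupport d ψ) (hu : ∀ k, localSchmidtProj d ψ (nbhd k) u = u) :
    ∃ c : ℂ, u = c • localVec d ψ := by
  obtain ⟨c, hc⟩ := h.eq_smul hψ fun k => congrArg Subtype.val (hu k)
  exact ⟨c, Subtype.ext hc⟩

/-- The definition of the neighborhood algebras makes every `𝒜_k`, `k ≠ j`, commute with this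
projector, which is all that membership in `𝒜_j` requires. -/
theorem localSchmidtProj_mem (hcomm : IsCommutingFamily (restrictedAlgebra d nbhd ψ))
    (hcompl : IsCompleteFamily (restrictedAlgebra d nbhd ψ)) (j : Fin K) :
    localSchmidtProj d ψ (nbhd j) ∈ restrictedAlgebra d nbhd ψ j :=
  @mem_of_commute_others (localSupport d ψ) inferInstance inferInstance inferInstance K
    (restrictedSubalgebra d nbhd ψ) hcomm hcompl
    (fun _ _ hY => exists_adjoint_mem_restrictedAlgebra hY)
    j _ fun _ hk _ hY => localSchmidtProj_commute hk.symm hY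

theorem exists_isInducedFactorization (hψ : ‖ψ‖ = 1) (hQLS : IsQLS d nbhd (ketbra ψ))
    (hcomm : IsCommutingFamily (restrictedAlgebra d nbhd ψ))
    (hcompl : IsCompleteFamily (restrictedAlgebra d nbhd ψ)) :
    ∃ (m : Fin K → ℕ) (W : localSupport d ψ ≃ₗᵢ[ℂ] Hilb (Cfg m)),
      IsInducedFactorization d nbhd ψ m W :=
  @exists_factorization (localSupport d ψ) inferInstance inferInstance inferInstance K
    (restrictedSubalgebra d nbhd ψ) (fun j => localSchmidtProj d ψ (nbhd j)) (localVec d ψ)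
    (norm_localVec hψ) hcomm hcompl
    (fun _ _ hY => exists_adjoint_mem_restrictedAlgebra hY)
    (localSchmidtProj_mem hcomm hcompl) (fun j => localSchmidtProj_mul_self (nbhd j))
    (fun j => localSchmidtProj_localVec (nbhd j)) (fun j => inner_localSchmidtProj_left (nbhd j))
    (hQLS.eq_smul_localVec hψ)

/-- The operator on the local support that corresponds to an operator on one of the factors. -/
def pullback {m : Fin K → ℕ} (W : localSupport d ψ ≃ₗᵢ[ℂ] Hilb (Cfg m)) (j : Fin K)
    (B : Op (Fin (m j))) : Module.End ℂ (localSupport d ψ) :=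
  (W.symm.toLinearEquiv : Hilb (Cfg m) →ₗ[ℂ] localSupport d ψ) ∘ₗ act (ampliate (single m j) B) ∘ₗ
    (W.toLinearEquiv : localSupport d ψ →ₗ[ℂ] Hilb (Cfg m))

theorem apply_pullback {m : Fin K → ℕ} (W : localSupport d ψ ≃ₗᵢ[ℂ] Hilb (Cfg m)) (j : Fin K)
    (B : Op (Fin (m j))) (v : localSupport d ψ) :
    W (pullback W j B v) = act (ampliate (single m j) B) (W v) :=
  W.apply_symm_apply _

theorem IsInducedFactorization.pullback_mem {m : Fin K → ℕ}
    {W : localSupport d ψ ≃ₗᵢ[ℂ] Hilb (Cfg m)} (hW : IsInducedFactorization d nbhd ψ m W)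
    (j : Fin K) (B : Op (Fin (m j))) : pullback W j B ∈ restrictedAlgebra d nbhd ψ j :=
  (hW j _).2 ⟨B, apply_pullback W j B⟩

theorem IsInducedFactorization.exists_prodVec (hψ : ‖ψ‖ = 1) (hQLS : IsQLS d nbhd (ketbra ψ))
    (hcomm : IsCommutingFamily (restrictedAlgebra d nbhd ψ))
    (hcompl : IsCompleteFamily (restrictedAlgebra d nbhd ψ)) {m : Fin K → ℕ}
    {W : localSupport d ψ ≃ₗᵢ[ℂ] Hilb (Cfg m)} (hW : IsInducedFactorization d nbhd ψ m W) :
    ∃ φ : ∀ j, Hilb (Fin (m j)), (∀ j, ‖φ j‖ = 1) ∧ prodVec φ = W (localVec d ψ) := by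
  refine exists_prodVec_eq_of_local_projections hQLS.pos
    (by rw [W.norm_map, norm_localVec hψ]) fun j => ?_
  obtain ⟨P, hP⟩ := (hW j _).1 (localSchmidtProj_mem hcomm hcompl j)
  refine ⟨P, fun C => ?_⟩
  have h := @projection_apply_eq_inner_smul (localSupport d ψ) inferInstance inferInstance
    inferInstance K (restrictedSubalgebra d nbhd ψ) (fun j => localSchmidtProj d ψ (nbhd j))
    (localVec d ψ)
    (norm_localVec hψ) (localSchmidtProj_mem hcomm hcompl)
    (fun j => localSchmidtProj_mul_self (nbhd j)) (fun j => localSchmidtProj_localVec (nbhd j))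
    (fun j => inner_localSchmidtProj_left (nbhd j)) hcomm (hQLS.eq_smul_localVec hψ)
    j _ (hW.pullback_mem j C)
  have h2 := congrArg W h
  rw [hP, apply_pullback, map_smul] at h2
  rw [h2, ← apply_pullback]
  congr 1
  exact (@inner_linearIsometryEquiv (localSupport d ψ) (Hilb (Cfg m)) inferInstance inferInstance
    inferInstance inferInstance W _ _).symm

end Induced

/-! ### Resetting maps -/

section KetBasis

variable {n : Type} [Fintype n] [DecidableEq n]

/-- The operator `|τ⟩⟨c|`, for a basis vector `|c⟩`. -/
def ketBasis (τ : Hilb n) (c : n) : Op n := Matrix.vecMulVec τ (Pi.single c 1)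

theorem act_ketBasis (τ : Hilb n) (c : n) (v : Hilb n) : act (ketBasis τ c) v = v c • τ := by
  ext a
  rw [act_apply]
  simp [ketBasis, Matrix.vecMulVec_apply, Pi.single_apply, mul_comm]

theorem sum_ketBasis_conjTranspose_mul {τ : Hilb n} (hτ : ‖τ‖ = 1) :
    ∑ c, (ketBasis τ c)ᴴ * ketBasis τ c = 1 := by
  refine op_ext fun v => ext_inner_left ℂ fun w => ?_
  simp only [act_sum_op, act_mul, act_one, inner_sum]
  simp only [← inner_act_left, act_ketBasis, inner_smul_left, inner_smul_right,
    inner_self_eq_norm_sq_to_K, hτ]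
  simp [PiLp.inner_apply, mul_comm]

theorem mul_ketBasis_of_act_eq_self {P : Op n} {τ : Hilb n} (h : act P τ = τ) (c : n) :
    P * ketBasis τ c = ketBasis τ c :=
  op_ext fun v => by rw [act_mul, act_ketBasis, map_smul, h]

end KetBasis

/-! ### Fixed vectors and kernels under commuting operators -/

section FixedSpace

variable {n : Type} [Fintype n] [DecidableEq n]

/-- The fixed vectors of an operator. -/
def fixedSpace (X : Op n) : Submodule ℂ (Hilb n) := LinearMap.eqLocus (act X) LinearMap.id

theorem mem_fixedSpace {X : Op n} {v : Hilb n} : v ∈ fixedSpace X ↔ act X v = v := Iff.rfl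

theorem act_mem_fixedSpace_of_commute {X Y : Op n} (h : X * Y = Y * X) {v : Hilb n}
    (hv : v ∈ fixedSpace X) : act Y v ∈ fixedSpace X := by
  rw [mem_fixedSpace, ← act_mul, h, act_mul, mem_fixedSpace.1 hv]

theorem act_mem_ker_of_commute {X Y : Op n} (h : X * Y = Y * X) {v : Hilb n}
    (hv : v ∈ LinearMap.ker (act X)) : act Y v ∈ LinearMap.ker (act X) := by
  rw [LinearMap.mem_ker, ← act_mul, h, act_mul, LinearMap.mem_ker.1 hv, map_zero]

end FixedSpace

/-! ### Composition and commutation of Kraus maps -/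

section KrausComp

variable {n α β : Type} [Fintype n] [DecidableEq n] [Fintype α] [Fintype β]

theorem krausMap_comp (K : α → Op n) (K' : β → Op n) (M : Op n) :
    krausMap K (krausMap K' M) = krausMap (fun p : α × β => K p.1 * K' p.2) M := by
  simp only [krausMap_apply, Fintype.sum_prod_type, Finset.mul_sum, Finset.sum_mul,
    Matrix.conjTranspose_mul, mul_assoc]

theorem sum_mul_conjTranspose_mul {K : α → Op n} {K' : β → Op n} (hK : ∑ a, (K a)ᴴ * K a = 1)
    (hK' : ∑ b, (K' b)ᴴ * K' b = 1) :
    ∑ p : α × β, (K p.1 * K' p.2)ᴴ * (K p.1 * K' p.2) = 1 := by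
  rw [Fintype.sum_prod_type, Finset.sum_comm, ← hK']
  refine Finset.sum_congr rfl fun b _ => ?_
  calc ∑ a, (K a * K' b)ᴴ * (K a * K' b) = (K' b)ᴴ * (∑ a, (K a)ᴴ * K a) * K' b := by
        simp only [Finset.mul_sum, Finset.sum_mul, Matrix.conjTranspose_mul, mul_assoc]
    _ = (K' b)ᴴ * K' b := by rw [hK, mul_one]

theorem krausMap_commute {K : α → Op n} {K' : β → Op n} (h : ∀ a b, K a * K' b = K' b * K a)
    (M : Op n) : krausMap K (krausMap K' M) = krausMap K' (krausMap K M) := by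
  rw [krausMap_comp, krausMap_comp, krausMap_apply, krausMap_apply, Fintype.sum_prod_type,
    Fintype.sum_prod_type, Finset.sum_comm]
  simp only [h]

end KrausComp

/-! ### Resetting single sites to their supports -/

section Reset

variable {N K : ℕ} {d : Fin N → ℕ} {nbhd : Fin K → Finset (Fin N)} {ψ : Hilb (Cfg d)}

theorem isNeighborhoodMap_id (S : Finset (Fin N)) :
    IsNeighborhoodMap d S LinearMap.id := by
  have h := isNeighborhoodMap_krausMap (d := d) (S := S) (α := Unit) (X := fun _ => 1) (by simp)
  convert h
  ext1 M
  simp [krausMap_apply, ampliate_one]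

theorem IsNeighborhoodMap.comp {S : Finset (Fin N)} {E E' : Op (Cfg d) →ₗ[ℂ] Op (Cfg d)}
    (hE : IsNeighborhoodMap d S E) (hE' : IsNeighborhoodMap d S E') :
    IsNeighborhoodMap d S (E ∘ₗ E') := by
  obtain ⟨r, X, hX, rfl⟩ := hE.exists_kraus
  obtain ⟨r', X', hX', rfl⟩ := hE'.exists_kraus
  have h := isNeighborhoodMap_krausMap (d := d) (S := S) (sum_mul_conjTranspose_mul hX hX')
  convert h
  ext1 M
  rw [LinearMap.comp_apply, krausMap_comp]
  simp only [ampliate_mul]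

theorem ampliate_zero {A B C : Type} [DecidableEq B] (e : C ≃ A × B) :
    ampliate e (0 : Op A) = 0 := by
  ext; simp [ampliate]

/-- The Kraus operators of the map that resets the part of a state outside `L` to `τ`. -/
def resetKraus {n : Type} [Fintype n] [DecidableEq n] (L : Submodule ℂ (Hilb n)) (τ : Hilb n) :
    Option n → Op n
  | none => proj L
  | some c => ketBasis τ c * (1 - proj L)

section

variable {n : Type} [Fintype n] [DecidableEq n] {L : Submodule ℂ (Hilb n)} {τ : Hilb n}

theorem sum_resetKraus_conjTranspose_mul (hτ : ‖τ‖ = 1) :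
    ∑ c, (resetKraus L τ c)ᴴ * resetKraus L τ c = 1 := by
  have h : (1 - proj L)ᴴ = 1 - proj L := by
    rw [Matrix.conjTranspose_sub, Matrix.conjTranspose_one, proj_conjTranspose]
  have h2 : (1 - proj L) * (1 - proj L) = 1 - proj L := by
    rw [mul_sub, sub_mul, sub_mul, proj_mul_self]; simp
  rw [Fintype.sum_option]
  calc (proj L)ᴴ * proj L + ∑ c, (ketBasis τ c * (1 - proj L))ᴴ * (ketBasis τ c * (1 - proj L))
      = proj L + (1 - proj L) * (∑ c, (ketBasis τ c)ᴴ * ketBasis τ c) * (1 - proj L) := by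
        rw [proj_conjTranspose, proj_mul_self, Finset.mul_sum, Finset.sum_mul]
        simp only [Matrix.conjTranspose_mul, h, mul_assoc]
    _ = 1 := by rw [sum_ketBasis_conjTranspose_mul hτ, mul_one, h2]; abel

theorem proj_mul_resetKraus (hτ : τ ∈ L) (c : Option n) :
    proj L * resetKraus L τ c = resetKraus L τ c := by
  cases c with
  | none => exact proj_mul_self L
  | some c =>
    rw [resetKraus, ← mul_assoc, mul_ketBasis_of_act_eq_self (act_proj_eq_self_iff.2 hτ)]

theorem resetKraus_some_mul (hτ : τ ∈ L) (c : n) (c' : Option n) :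
    resetKraus L τ (some c) * resetKraus L τ c' = 0 := by
  rw [← proj_mul_resetKraus hτ c', ← mul_assoc, resetKraus, mul_assoc (ketBasis τ c), sub_mul,
    one_mul, proj_mul_self, sub_self, mul_zero, zero_mul]

theorem resetKraus_some_mul_proj (c : n) : resetKraus L τ (some c) * proj L = 0 := by
  rw [resetKraus, mul_assoc, sub_mul, one_mul, proj_mul_self, sub_self, mul_zero]

end

variable (d ψ) in
/-- The map that resets the part of a state outside the support of `ψ` at the site `i`. -/
def siteReset (τ : ∀ i, Hilb (Fin (d i))) (i : Fin N) : Module.End ℂ (Op (Cfg d)) :=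
  krausMap fun c => ampliate (single d i) (resetKraus (siteSupport d ψ i) (τ i) c)

variable {τ : ∀ i, Hilb (Fin (d i))}

theorem exists_unit_mem_siteSupport (hψ : ψ ≠ 0) (i : Fin N) :
    ∃ τ ∈ siteSupport d ψ i, ‖τ‖ = 1 := by
  obtain ⟨b, hb⟩ : ∃ b, slice (single d i) ψ b ≠ 0 := by
    by_contra! h
    exact hψ (slice_ext (single d i) fun b => by rw [h b]; rfl)
  refine ⟨((‖slice (single d i) ψ b‖ : ℂ)⁻¹) • slice (single d i) ψ b,
    Submodule.smul_mem _ _ (slice_single_mem_siteSupport i b), ?_⟩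
  rw [norm_smul, norm_inv, Complex.norm_real, norm_norm, inv_mul_cancel₀ (norm_ne_zero_iff.2 hb)]

theorem isNeighborhoodMap_siteReset (hτ : ∀ i, ‖τ i‖ = 1) {S : Finset (Fin N)} {i : Fin N}
    (hi : i ∈ S) : IsNeighborhoodMap d S (siteReset d ψ τ i) := by
  rw [siteReset]
  simp only [ampliate_single_of_mem hi]
  exact isNeighborhoodMap_krausMap
    (sum_ampliate_conjTranspose_mul _ (sum_resetKraus_conjTranspose_mul (hτ i)))

theorem siteReset_siteReset (hτ : ∀ i, τ i ∈ siteSupport d ψ i) (i : Fin N) (M : Op (Cfg d)) :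
    siteReset d ψ τ i (siteReset d ψ τ i M) = siteReset d ψ τ i M := by
  rw [siteReset, krausMap_comp, krausMap_apply, krausMap_apply, Fintype.sum_prod_type,
    Fintype.sum_option]
  simp only [← ampliate_mul, resetKraus_some_mul (hτ i)]
  simp only [ampliate_zero, zero_mul, Finset.sum_const_zero, add_zero]
  refine Finset.sum_congr rfl fun c _ => ?_
  rw [show resetKraus (siteSupport d ψ i) (τ i) none = proj (siteSupport d ψ i) from rfl,
    proj_mul_resetKraus (hτ i)]

theorem siteReset_apply_mem_fixedSpace (hτ : ∀ i, τ i ∈ siteSupport d ψ i) (i : Fin N)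
    (M : Op (Cfg d)) (v : Hilb (Cfg d)) :
    act (siteReset d ψ τ i M) v ∈ fixedSpace (siteProj d ψ i) := by
  refine act_krausMap_mem (L := ⊤) (fun c u _ => ?_) (fun _ => Submodule.mem_top) v
  rw [mem_fixedSpace, siteProj, ← act_mul, ← ampliate_mul, proj_mul_resetKraus (hτ i)]

/-- On the site support only the Kraus operator `none` acts, as the identity; hence a site reset
does nothing to states supported there. -/
theorem act_ampliate_resetKraus {i : Fin N} {u : Hilb (Cfg d)}
    (hu : u ∈ fixedSpace (siteProj d ψ i)) (c : Option (Fin (d i))) :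
    act (ampliate (single d i) (resetKraus (siteSupport d ψ i) (τ i) c)) u =
      (if c = none then (1 : ℂ) else 0) • u := by
  cases c with
  | none =>
    rw [if_pos rfl, one_smul]
    exact hu
  | some c =>
    nth_rw 1 [← mem_fixedSpace.1 hu]
    rw [siteProj, ← act_mul, ← ampliate_mul, resetKraus_some_mul_proj, ampliate_zero]
    simp

theorem siteReset_apply_mem {L : Submodule ℂ (Hilb (Cfg d))} {i : Fin N}
    (hL : L ≤ fixedSpace (siteProj d ψ i)) {M : Op (Cfg d)} (hM : ∀ v, act M v ∈ L)
    (v : Hilb (Cfg d)) : act (siteReset d ψ τ i M) v ∈ L := by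
  refine act_krausMap_mem (fun c u hu => ?_) hM v
  rw [act_ampliate_resetKraus (hL hu)]
  exact L.smul_mem _ hu

theorem siteReset_ketbra (hτ : ∀ i, ‖τ i‖ = 1) (i : Fin N) :
    siteReset d ψ τ i (ketbra ψ) = ketbra ψ :=
  krausMap_ketbra_eq_self
    (sum_ampliate_conjTranspose_mul _ (sum_resetKraus_conjTranspose_mul (hτ i)))
    (act_ampliate_resetKraus (mem_localSupport_iff.1 (self_mem_localSupport d ψ) i))

theorem IsNeighborhoodMap.siteReset_commute {S : Finset (Fin N)}
    {E : Op (Cfg d) →ₗ[ℂ] Op (Cfg d)} (hE : IsNeighborhoodMap d S E) {i : Fin N} (hi : i ∉ S)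
    (M : Op (Cfg d)) : E (siteReset d ψ τ i M) = siteReset d ψ τ i (E M) := by
  obtain ⟨r, X, -, rfl⟩ := hE.exists_kraus
  exact krausMap_commute (fun a b => ampliate_split_commute_single hi _ _) M

theorem IsNeighborhoodMap.apply_mem_ker_siteProj {S : Finset (Fin N)}
    {E : Op (Cfg d) →ₗ[ℂ] Op (Cfg d)} (hE : IsNeighborhoodMap d S E) {i : Fin N} (hi : i ∉ S)
    {M : Op (Cfg d)} (hM : ∀ v, act M v ∈ LinearMap.ker (act (siteProj d ψ i)))
    (v : Hilb (Cfg d)) : act (E M) v ∈ LinearMap.ker (act (siteProj d ψ i)) := by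
  obtain ⟨r, X, -, rfl⟩ := hE.exists_kraus
  exact act_krausMap_mem
    (fun a u hu => act_mem_ker_of_commute (ampliate_split_commute_single hi _ _).symm hu) hM v

theorem siteReset_commute (hτ : ∀ i, ‖τ i‖ = 1) (i k : Fin N) (M : Op (Cfg d)) :
    siteReset d ψ τ i (siteReset d ψ τ k M) = siteReset d ψ τ k (siteReset d ψ τ i M) := by
  by_cases h : i = k
  · rw [h]
  · exact (isNeighborhoodMap_siteReset hτ (Finset.mem_singleton_self i)).siteReset_commute
      (by simpa using Ne.symm h) M

theorem list_prod_siteReset_commute (hτ : ∀ i, ‖τ i‖ = 1) (l : List (Fin N)) (i : Fin N)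
    (M : Op (Cfg d)) : (l.map (siteReset d ψ τ)).prod (siteReset d ψ τ i M) =
      siteReset d ψ τ i ((l.map (siteReset d ψ τ)).prod M) := by
  induction l with
  | nil => rfl
  | cons k l ih =>
    rw [List.map_cons, List.prod_cons, Module.End.mul_apply, ih, Module.End.mul_apply,
      siteReset_commute hτ]

/-- The site resets commute and are idempotent, so one that occurs in the product absorbs a further
copy. -/
theorem list_prod_siteReset_absorb (hτ : ∀ i, ‖τ i‖ = 1) (hτ' : ∀ i, τ i ∈ siteSupport d ψ i)
    {l : List (Fin N)} {i : Fin N} (hi : i ∈ l) (M : Op (Cfg d)) :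
    (l.map (siteReset d ψ τ)).prod (siteReset d ψ τ i M) =
      (l.map (siteReset d ψ τ)).prod M := by
  induction l with
  | nil => exact absurd hi List.not_mem_nil
  | cons k l ih =>
    rw [List.map_cons, List.prod_cons, Module.End.mul_apply, Module.End.mul_apply]
    rcases List.mem_cons.1 hi with rfl | h
    · rw [list_prod_siteReset_commute hτ, siteReset_siteReset hτ']
    · rw [ih h]

end Reset

/-! ### Robust stabilization -/

section Stabilization

variable {N K : ℕ} {d : Fin N → ℕ} {nbhd : Fin K → Finset (Fin N)} {ψ : Hilb (Cfg d)}

theorem ampliate_proj_localSupportOn {S : Finset (Fin N)} {v : Hilb (Cfg d)}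
    (hv : v ∈ localSupport d ψ) :
    act (ampliate (split d S) (proj (localSupportOn d ψ S))) v = v :=
  (act_ampliate_eq_self_iff _).2 fun b => slice_mem_localSupportOn hv b

/-- The operators of a neighborhood algebra that reset the corresponding factor to its factor
of `ψ`. -/
theorem IsInducedFactorization.exists_reset_operators {m : Fin K → ℕ}
    {W : localSupport d ψ ≃ₗᵢ[ℂ] Hilb (Cfg m)} (hW : IsInducedFactorization d nbhd ψ m W)
    (hproj : ∀ j, localSchmidtProj d ψ (nbhd j) ∈ restrictedAlgebra d nbhd ψ j)
    {φ : ∀ j, Hilb (Fin (m j))} (hφ : ∀ j, ‖φ j‖ = 1) (hφψ : prodVec φ = W (localVec d ψ))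
    (j : Fin K) :
    ∃ A : Fin (m j) → Op (Cfg d), (∀ a, A a ∈ neighborhoodAlgebra d nbhd ψ j) ∧
      (∀ v ∈ localSupport d ψ, ∑ a, act ((A a)ᴴ * A a) v = v) ∧
      (∀ a, ∀ v ∈ localSupport d ψ, act (schmidtProj d ψ (nbhd j)) (act (A a) v) = act (A a) v) ∧
      ∀ a, ∃ c : ℂ, act (A a) ψ = c • ψ := by
  have hY := fun a => hW.pullback_mem j (ketBasis (φ j) a)
  choose A hA hYA using hY
  obtain ⟨P, hP⟩ := (hW j _).1 (hproj j)
  -- `P - 1` on the `j`-th factor kills the product vector of `ψ`; the other factors are unit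
  -- vectors, so the `j`-th one must be killed.
  have hPφ : act P (φ j) = φ j := by
    have h1 : act (ampliate (single m j) (P - 1)) (prodVec φ) = 0 := by
      rw [ampliate_sub, act_sub_op, ampliate_one, act_one, hφψ, ← hP, localSchmidtProj_localVec,
        sub_self]
    have h2 : ∏ k, ‖Function.update φ j (act (P - 1) (φ j)) k‖ = 0 := by
      rw [← norm_prodVec, ← act_ampliate_single_prodVec, h1, norm_zero]
    obtain ⟨k, -, hk⟩ := Finset.prod_eq_zero_iff.1 h2
    by_cases hkj : k = j
    · subst hkj
      rw [Function.update_self, norm_eq_zero, act_sub_op, act_one] at hk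
      exact sub_eq_zero.1 hk
    · rw [Function.update_of_ne hkj, hφ] at hk
      exact absurd hk one_ne_zero
  refine ⟨A, hA, fun v hv => ?_, fun a v hv => ?_, fun a => ?_⟩
  · have hmem : ∑ a, act ((A a)ᴴ * A a) v ∈ localSupport d ψ :=
      Submodule.sum_mem _ fun a _ => by
        rw [act_mul]
        exact act_mem_localSupport (conjTranspose_mem_neighborhoodAlgebra (hA a))
          (act_mem_localSupport (hA a) hv)
    have hinner : ∀ w ∈ localSupport d ψ, inner ℂ w (∑ a, act ((A a)ᴴ * A a) v) = inner ℂ w v := by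
      intro w hw
      have h1 : ∀ a, inner ℂ w (act ((A a)ᴴ * A a) v) =
          inner ℂ (W ⟨w, hw⟩) (act (ampliate (single m j)
            ((ketBasis (φ j) a)ᴴ * ketBasis (φ j) a)) (W ⟨v, hv⟩)) := by
        intro a
        rw [act_mul, ← inner_act_left, ampliate_mul, act_mul, ← ampliate_conjTranspose,
          ← inner_act_left, ← apply_pullback, ← apply_pullback]
        refine Eq.trans ?_ (@inner_linearIsometryEquiv (localSupport d ψ) (Hilb (Cfg m))
          inferInstance inferInstance inferInstance inferInstance W _ _).symm
        rw [← hYA a ⟨w, hw⟩, ← hYA a ⟨v, hv⟩]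
        rfl
      rw [inner_sum]
      simp only [h1]
      rw [← inner_sum, ← act_sum_op, ← ampliate_sum, sum_ketBasis_conjTranspose_mul (hφ j),
        ampliate_one, act_one]
      exact @inner_linearIsometryEquiv (localSupport d ψ) (Hilb (Cfg m))
        inferInstance inferInstance inferInstance inferInstance W ⟨w, hw⟩ ⟨v, hv⟩
    rw [← sub_eq_zero, ← inner_self_eq_zero (𝕜 := ℂ), inner_sub_right,
      hinner _ (Submodule.sub_mem _ hmem hv), sub_self]
  · have h1 : localSchmidtProj d ψ (nbhd j) (pullback W j (ketBasis (φ j) a) ⟨v, hv⟩) =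
        pullback W j (ketBasis (φ j) a) ⟨v, hv⟩ := by
      apply W.injective
      rw [hP, apply_pullback, ← act_mul, ← ampliate_mul, mul_ketBasis_of_act_eq_self hPφ]
    have h2 := congrArg Subtype.val h1
    rwa [coe_localSchmidtProj, hYA] at h2
  · refine ⟨φ j a, ?_⟩
    have h1 : pullback W j (ketBasis (φ j) a) (localVec d ψ) = φ j a • localVec d ψ := by
      apply W.injective
      rw [apply_pullback, map_smul, ← hφψ, act_ampliate_single_prodVec, act_ketBasis,
        prodVec_smul_update]
    have h2 := congrArg Subtype.val h1
    rwa [hYA] at h2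

/-- A neighborhood map that, on the local support, resets the factor of one neighborhood. -/
theorem IsInducedFactorization.exists_factorReset (hψ : ‖ψ‖ = 1) {m : Fin K → ℕ}
    {W : localSupport d ψ ≃ₗᵢ[ℂ] Hilb (Cfg m)} (hW : IsInducedFactorization d nbhd ψ m W)
    (hproj : ∀ j, localSchmidtProj d ψ (nbhd j) ∈ restrictedAlgebra d nbhd ψ j)
    {φ : ∀ j, Hilb (Fin (m j))} (hφ : ∀ j, ‖φ j‖ = 1) (hφψ : prodVec φ = W (localVec d ψ))
    (j : Fin K) :
    ∃ F : Op (Cfg d) →ₗ[ℂ] Op (Cfg d), IsNeighborhoodMap d (nbhd j) F ∧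
      F (ketbra ψ) = ketbra ψ ∧
      (∀ M, (∀ v, act M v ∈ localSupport d ψ) →
        ∀ v, act (F M) v ∈ localSupport d ψ ⊓ fixedSpace (schmidtProj d ψ (nbhd j))) ∧
      (∀ L ≤ localSupport d ψ, (∀ A ∈ neighborhoodAlgebra d nbhd ψ j, ∀ u ∈ L, act A u ∈ L) →
        ∀ M, (∀ v, act M v ∈ L) → ∀ v, act (F M) v ∈ L) := by
  have hψ0 : ψ ≠ 0 := fun h => by simp [h] at hψ
  obtain ⟨A, hA, hsum, hfix, hAψ⟩ := hW.exists_reset_operators hproj hφ hφψ j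
  choose X hXA hX hX' hX'' using hA
  set Q := proj (localSupportOn d ψ (nbhd j)) with hQ
  have hQQ : Q * Q = Q := proj_mul_self _
  have hQs : Qᴴ = Q := proj_conjTranspose _
  -- The normalization of the `A a` is known on the global local support; each vector in the range
  -- of `Q` is, up to a nonzero scalar, a slice of a vector there, which gives the normalization of
  -- the `X a`.
  have hZ : Q * (∑ a, (X a)ᴴ * X a) * Q = Q := by
    refine op_ext fun u => ?_
    obtain ⟨v, hv, b, c, hc, hvb⟩ := exists_slice_eq_smul hψ0 (act_proj_mem _ u :
      act Q u ∈ localSupportOn d ψ (nbhd j))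
    have h1 : act (∑ a, (X a)ᴴ * X a) (act Q u) = act Q u := by
      have h2 := congrArg (fun w => slice (split d (nbhd j)) w b) (hsum v hv)
      simp only [hXA, ampliate_conjTranspose, ← ampliate_mul] at h2
      rw [← act_sum_op, ← ampliate_sum, slice_act_ampliate, hvb, map_smul] at h2
      exact smul_right_injective _ hc h2
    rw [act_mul, act_mul, h1, ← act_mul, hQQ]
  -- The extra Kraus operator `1 - Q` restores trace preservation on the whole neighborhood and
  -- vanishes on the local support.
  let Y : Option (Fin (m j)) → Op (SubCfg d (nbhd j))
    | none => 1 - Q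
    | some a => X a * Q
  have hYsum : ∑ a, (Y a)ᴴ * Y a = 1 := by
    rw [Fintype.sum_option]
    calc (1 - Q)ᴴ * (1 - Q) + ∑ a, (X a * Q)ᴴ * (X a * Q)
        = (1 - Q) * (1 - Q) + Q * (∑ a, (X a)ᴴ * X a) * Q := by
          rw [Matrix.conjTranspose_sub, Matrix.conjTranspose_one, hQs, Finset.mul_sum,
            Finset.sum_mul]
          simp only [Matrix.conjTranspose_mul, hQs, mul_assoc]
      _ = 1 := by rw [hZ, mul_sub, sub_mul, sub_mul, hQQ]; simp
  have hnone : ∀ v ∈ localSupport d ψ, act (ampliate (split d (nbhd j)) (Y none)) v = 0 := by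
    intro v hv
    change act (ampliate _ (1 - Q)) v = 0
    rw [ampliate_sub, act_sub_op, ampliate_one, act_one, ampliate_proj_localSupportOn hv, sub_self]
  have hsome : ∀ a, ∀ v ∈ localSupport d ψ,
      act (ampliate (split d (nbhd j)) (Y (some a))) v = act (A a) v := by
    intro a v hv
    change act (ampliate _ (X a * Q)) v = _
    rw [ampliate_mul, act_mul, ampliate_proj_localSupportOn hv, hXA]
  have hAmem : ∀ a, A a ∈ neighborhoodAlgebra d nbhd ψ j :=
    fun a => ⟨X a, hXA a, hX a, hX' a, hX'' a⟩
  refine ⟨krausMap fun a => ampliate (split d (nbhd j)) (Y a), isNeighborhoodMap_krausMap hYsum,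
    ?_, fun M hM => act_krausMap_mem ?_ hM, fun L hL hLA M hM => act_krausMap_mem ?_ hM⟩
  · choose c hc using hAψ
    refine krausMap_ketbra_eq_self (c := fun a => a.elim 0 c)
      (sum_ampliate_conjTranspose_mul _ hYsum) fun a => ?_
    cases a with
    | none => rw [hnone _ (self_mem_localSupport d ψ)]; simp
    | some a => rw [hsome a _ (self_mem_localSupport d ψ), hc]; rfl
  · intro a u hu
    cases a with
    | none => rw [hnone u hu]; exact Submodule.zero_mem _
    | some a =>
      rw [hsome a u hu]
      exact ⟨act_mem_localSupport (hAmem a) hu, hfix a u hu⟩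
  · intro a u hu
    cases a with
    | none => rw [hnone u (hL hu)]; exact Submodule.zero_mem _
    | some a =>
      rw [hsome a u (hL hu)]
      exact hLA _ (hAmem a) u hu

/-- The properties of neighborhood maps that make them prepare `ψ` in any order. -/
structure IsResettingFamily (nbhd : Fin K → Finset (Fin N)) (ψ : Hilb (Cfg d))
    (τ : ∀ i, Hilb (Fin (d i))) (E : Fin K → Op (Cfg d) →ₗ[ℂ] Op (Cfg d)) : Prop where
  isNeighborhoodMap : ∀ j, IsNeighborhoodMap d (nbhd j) (E j)
  map_ketbra : ∀ j, E j (ketbra ψ) = ketbra ψ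
  absorb : ∀ j, ∀ i ∈ nbhd j, ∀ M, E j (siteReset d ψ τ i M) = E j M
  range_le : ∀ j M, (∀ v, act M v ∈ localSupport d ψ) →
    ∀ v, act (E j M) v ∈ localSupport d ψ ⊓ fixedSpace (schmidtProj d ψ (nbhd j))
  invariant : ∀ j, ∀ L ≤ localSupport d ψ,
    (∀ A ∈ neighborhoodAlgebra d nbhd ψ j, ∀ u ∈ L, act A u ∈ L) →
      ∀ M, (∀ v, act M v ∈ L) → ∀ v, act (E j M) v ∈ L

theorem localSupport_le_fixedSpace (i : Fin N) :
    localSupport d ψ ≤ fixedSpace (siteProj d ψ i) := fun _ hv => mem_localSupport_iff.1 hv i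

theorem exists_isResettingFamily (hψ : ‖ψ‖ = 1) (hQLS : IsQLS d nbhd (ketbra ψ))
    (hcomm : IsCommutingFamily (restrictedAlgebra d nbhd ψ))
    (hcompl : IsCompleteFamily (restrictedAlgebra d nbhd ψ)) :
    ∃ τ, (∀ i, τ i ∈ siteSupport d ψ i) ∧ (∀ i, ‖τ i‖ = 1) ∧
      ∃ E, IsResettingFamily nbhd ψ τ E := by
  have hψ0 : ψ ≠ 0 := fun h => by simp [h] at hψ
  choose τ hτ hτ1 using exists_unit_mem_siteSupport hψ0
  obtain ⟨m, W, hW⟩ := exists_isInducedFactorization hψ hQLS hcomm hcompl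
  obtain ⟨φ, hφ, hφψ⟩ := hW.exists_prodVec hψ hQLS hcomm hcompl
  choose F hF hFψ hFr hFi using
    hW.exists_factorReset hψ (localSchmidtProj_mem hcomm hcompl) hφ hφψ
  let R : Finset (Fin N) → Module.End ℂ (Op (Cfg d)) :=
    fun S => (S.toList.map (siteReset d ψ τ)).prod
  have hRlist : ∀ S : Finset (Fin N), ∀ l : List (Fin N), (∀ i ∈ l, i ∈ S) →
      IsNeighborhoodMap d S (l.map (siteReset d ψ τ)).prod := by
    intro S l
    induction l with
    | nil => exact fun _ => isNeighborhoodMap_id S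
    | cons i l ih =>
      intro h
      rw [List.map_cons, List.prod_cons]
      exact (isNeighborhoodMap_siteReset hτ1 (h i List.mem_cons_self)).comp
        (ih fun k hk => h k (List.mem_cons_of_mem _ hk))
  have hRψ : ∀ l : List (Fin N), (l.map (siteReset d ψ τ)).prod (ketbra ψ) = ketbra ψ := by
    intro l
    induction l with
    | nil => rfl
    | cons i l ih => rw [List.map_cons, List.prod_cons, Module.End.mul_apply, ih,
        siteReset_ketbra hτ1]
  have hRmem : ∀ L ≤ localSupport d ψ, ∀ l : List (Fin N), ∀ M, (∀ v, act M v ∈ L) →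
      ∀ v, act ((l.map (siteReset d ψ τ)).prod M) v ∈ L := by
    intro L hL l M hM
    induction l with
    | nil => exact hM
    | cons i l ih =>
      rw [List.map_cons, List.prod_cons, Module.End.mul_apply]
      exact siteReset_apply_mem (hL.trans (localSupport_le_fixedSpace i)) ih
  -- The site resets act before the factor reset; this order is what lets the composite absorb a
  -- preceding site reset.
  refine ⟨τ, hτ, hτ1, fun j => F j ∘ₗ R (nbhd j), fun j => ?_, fun j => ?_, fun j i hi M => ?_,
    fun j M hM => ?_, fun j L hL hLA M hM => ?_⟩
  · exact (hF j).comp (hRlist _ _ fun i hi => Finset.mem_toList.1 hi)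
  · rw [LinearMap.comp_apply, hRψ, hFψ]
  · rw [LinearMap.comp_apply, LinearMap.comp_apply,
      list_prod_siteReset_absorb hτ1 hτ (Finset.mem_toList.2 hi)]
  · exact hFr j _ (hRmem _ le_rfl _ M hM)
  · exact hFi j L hL hLA _ (hRmem L hL _ M hM)

variable (nbhd ψ) in
/-- The neighborhoods with index in `J` cover every site with a proper support, and the Schmidt
span projectors of the others are trivial on the local support. -/
def IsSufficient (J : Set (Fin K)) : Prop :=
  (∀ i, siteSupport d ψ i = ⊤ ∨ ∃ j ∈ J, i ∈ nbhd j) ∧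
    ∀ j ∉ J, localSupport d ψ ≤ fixedSpace (schmidtProj d ψ (nbhd j))

/-- If a site with proper support were in no neighborhood, an operator there could send `ψ` to a
nonzero vector orthogonal to the site support. All `Π_k` would still fix it, so it would be a
multiple of `ψ`, which the site projector fixes rather than kills. -/
theorem isSufficient_univ (hψ : ‖ψ‖ = 1) (hQLS : IsQLS d nbhd (ketbra ψ)) :
    IsSufficient nbhd ψ Set.univ := by
  have hψ0 : ψ ≠ 0 := fun h => by simp [h] at hψ
  refine ⟨fun i => ?_, fun j hj => absurd (Set.mem_univ j) hj⟩
  by_contra! h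
  obtain ⟨htop, hi⟩ := h
  obtain ⟨x, hx, hx0⟩ := Submodule.exists_mem_ne_zero_of_ne_bot
    fun h => htop (Submodule.orthogonal_eq_bot_iff.1 h)
  obtain ⟨b, hb⟩ : ∃ b, x b ≠ 0 := by
    by_contra! h
    exact hx0 (PiLp.ext h)
  obtain ⟨z, hz⟩ : ∃ z, ψ z ≠ 0 := by
    by_contra! h
    exact hψ0 (PiLp.ext h)
  set u := act (ampliate (single d i) (ketBasis x (z i))) ψ with hu
  have hPu : act (siteProj d ψ i) u = 0 := by
    have : proj (siteSupport d ψ i) * ketBasis x (z i) = 0 := op_ext fun v => by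
      rw [act_mul, act_ketBasis, map_smul, act_proj_eq_zero_iff.2 hx]; simp
    rw [hu, siteProj, ← act_mul, ← ampliate_mul, this, ampliate_zero]
    simp
  obtain ⟨c, hc⟩ := hQLS.eq_smul hψ (u := u) fun k => by
    rw [hu, schmidtProj, ← act_mul, ampliate_split_commute_single (hi k trivial), act_mul]
    exact congrArg _ (act_schmidtProj_self (nbhd k))
  have hu0 : u = 0 := by
    rw [hc, map_smul, mem_localSupport_iff.1 (self_mem_localSupport d ψ) i, ← hc] at hPu
    exact hPu
  have h1 : u (Function.update z i b) = x b * ψ z := by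
    rw [hu, act_ampliate_single]
    simp [ketBasis, Matrix.vecMulVec_apply, Pi.single_apply]
  rw [hu0] at h1
  exact mul_ne_zero hb hz h1.symm

/-! ### Lists of resetting maps prepare `ψ` exactly when they are sufficient -/

variable {τ : ∀ i, Hilb (Fin (d i))} {E : Fin K → Op (Cfg d) →ₗ[ℂ] Op (Cfg d)}

theorem applyMaps_cons {n : Type} (F : Op n →ₗ[ℂ] Op n) (L : List (Op n →ₗ[ℂ] Op n)) (σ : Op n) :
    applyMaps (F :: L) σ = applyMaps L (F σ) := rfl

/-- The reset slides past the maps that do not touch site `i` and is absorbed by the first one that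
does. -/
theorem IsResettingFamily.applyMaps_siteReset (hE : IsResettingFamily nbhd ψ τ E)
    {L : List (Fin K)} {i : Fin N} (hi : ∃ j ∈ L, i ∈ nbhd j) (M : Op (Cfg d)) :
    applyMaps (L.map E) (siteReset d ψ τ i M) = applyMaps (L.map E) M := by
  induction L generalizing M with
  | nil => simp at hi
  | cons k L ih =>
    rw [List.map_cons, applyMaps_cons, applyMaps_cons]
    by_cases hk : i ∈ nbhd k
    · rw [hE.absorb k i hk]
    · rw [(hE.isNeighborhoodMap k).siteReset_commute hk]
      obtain ⟨j, hj, hij⟩ := hi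
      rcases List.mem_cons.1 hj with rfl | hj
      · exact absurd hij hk
      · exact ih ⟨j, hj, hij⟩ _

theorem applyMaps_mem {n : Type} [Fintype n] [DecidableEq n] {L : List (Op n →ₗ[ℂ] Op n)}
    {V : Submodule ℂ (Hilb n)}
    (h : ∀ F ∈ L, ∀ M, (∀ v, act M v ∈ V) → ∀ v, act (F M) v ∈ V) {M : Op n}
    (hM : ∀ v, act M v ∈ V) : ∀ v, act (applyMaps L M) v ∈ V := by
  induction L generalizing M with
  | nil => exact hM
  | cons F L ih =>
    exact ih (fun F' hF' => h F' (List.mem_cons_of_mem _ hF')) (h F List.mem_cons_self M hM)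

theorem IsResettingFamily.isDensity_applyMaps (hE : IsResettingFamily nbhd ψ τ E)
    (L : List (Fin K)) {σ : Op (Cfg d)} (hσ : IsDensity σ) :
    IsDensity (applyMaps (L.map E) σ) := by
  induction L generalizing σ with
  | nil => exact hσ
  | cons k L ih => exact ih ((hE.isNeighborhoodMap k).isDensity hσ)

theorem act_mem_localSupport_inf_fixedSpace {j k : Fin K} (hkj : k ≠ j) {A : Op (Cfg d)}
    (hA : A ∈ neighborhoodAlgebra d nbhd ψ k) {u : Hilb (Cfg d)}
    (hu : u ∈ localSupport d ψ ⊓ fixedSpace (schmidtProj d ψ (nbhd j))) :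
    act A u ∈ localSupport d ψ ⊓ fixedSpace (schmidtProj d ψ (nbhd j)) := by
  refine ⟨act_mem_localSupport hA hu.1, ?_⟩
  obtain ⟨X, -, -, -, h⟩ := hA
  rw [SetLike.mem_coe, mem_fixedSpace, ← h j hkj.symm u hu.1, mem_fixedSpace.1 hu.2]

theorem act_mem_localSupport_inf_ker {j k : Fin K} (hkj : k ≠ j) {A : Op (Cfg d)}
    (hA : A ∈ neighborhoodAlgebra d nbhd ψ k) {u : Hilb (Cfg d)}
    (hu : u ∈ localSupport d ψ ⊓ LinearMap.ker (act (schmidtProj d ψ (nbhd j)))) :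
    act A u ∈ localSupport d ψ ⊓ LinearMap.ker (act (schmidtProj d ψ (nbhd j))) := by
  refine ⟨act_mem_localSupport hA hu.1, ?_⟩
  obtain ⟨X, -, -, -, h⟩ := hA
  rw [SetLike.mem_coe, LinearMap.mem_ker, ← h j hkj.symm u hu.1, LinearMap.mem_ker.1 hu.2, map_zero]

/-- Map `j` moves the range into that of `Π_j`, and later maps keep it there, because the operators
of the other neighborhood algebras commute with `Π_j` on the local support. -/
theorem IsResettingFamily.applyMaps_mem_fixedSpace (hE : IsResettingFamily nbhd ψ τ E)
    {L : List (Fin K)} {j : Fin K} {M : Op (Cfg d)} (hM : ∀ v, act M v ∈ localSupport d ψ)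
    (hj : (∀ v, act M v ∈ fixedSpace (schmidtProj d ψ (nbhd j))) ∨ j ∈ L) (v : Hilb (Cfg d)) :
    act (applyMaps (L.map E) M) v ∈ fixedSpace (schmidtProj d ψ (nbhd j)) := by
  induction L generalizing M with
  | nil => exact hj.resolve_right List.not_mem_nil v
  | cons k L ih =>
    rw [List.map_cons, applyMaps_cons]
    refine ih (fun v => (hE.range_le k M hM v).1) ?_
    by_cases hkj : k = j
    · subst hkj
      exact Or.inl fun v => (hE.range_le k M hM v).2
    · rcases hj with hj | hj
      · exact Or.inl fun v => (hE.invariant k _ inf_le_left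
          (fun A hA u hu => act_mem_localSupport_inf_fixedSpace hkj hA hu) M
          (fun v => ⟨hM v, hj v⟩) v).2
      · exact Or.inr ((List.mem_cons.1 hj).resolve_left (Ne.symm hkj))

theorem IsResettingFamily.prepares (hE : IsResettingFamily nbhd ψ τ E) (hψ : ‖ψ‖ = 1)
    (hQLS : IsQLS d nbhd (ketbra ψ)) (hτ : ∀ i, τ i ∈ siteSupport d ψ i) (hτ1 : ∀ i, ‖τ i‖ = 1)
    {L : List (Fin K)} (hL : IsSufficient nbhd ψ {j | j ∈ L}) :
    Prepares (L.map E) (ketbra ψ) := by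
  intro σ hσ
  -- The input may be replaced by one supported in the local support without changing the output:
  -- where the site support is proper, a site reset is inserted, which the list absorbs.
  have key : ∀ s : Finset (Fin N), ∃ σ', IsDensity σ' ∧
      applyMaps (L.map E) σ' = applyMaps (L.map E) σ ∧
      ∀ i ∈ s, ∀ v, act σ' v ∈ fixedSpace (siteProj d ψ i) := by
    intro s
    induction s using Finset.induction with
    | empty => exact ⟨σ, hσ, rfl, by simp⟩
    | insert i s _ ih =>
      obtain ⟨σ', hd, happ, hs⟩ := ih
      rcases hL.1 i with htop | hcov
      · refine ⟨σ', hd, happ, fun k hk => ?_⟩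
        rcases Finset.mem_insert.1 hk with rfl | hk
        · intro v
          rw [mem_fixedSpace, siteProj, htop, proj_top, ampliate_one, act_one]
        · exact hs k hk
      · refine ⟨siteReset d ψ τ i σ',
          (isNeighborhoodMap_siteReset hτ1 (Finset.mem_singleton_self i)).isDensity hd, ?_,
          fun k hk => ?_⟩
        · rw [hE.applyMaps_siteReset hcov, happ]
        · by_cases hki : k = i
          · subst hki
            exact siteReset_apply_mem_fixedSpace hτ k σ'
          · exact act_krausMap_mem (fun c u hu => act_mem_fixedSpace_of_commute
              (ampliate_single_commute hki _ _) hu)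
              (hs k ((Finset.mem_insert.1 hk).resolve_left hki))
  obtain ⟨σ', hd, happ, hs⟩ := key Finset.univ
  have hσ' : ∀ v, act σ' v ∈ localSupport d ψ := fun v =>
    mem_localSupport_iff.2 fun i => hs i (Finset.mem_univ i) v
  rw [← happ]
  refine eq_ketbra_of_range hψ (hE.isDensity_applyMaps L hd) fun v => hQLS.eq_smul hψ fun j => ?_
  by_cases hj : j ∈ L
  · exact hE.applyMaps_mem_fixedSpace hσ' (Or.inr hj) v
  · exact hE.applyMaps_mem_fixedSpace hσ' (Or.inl fun v => hL.2 j hj (hσ' v)) v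

/-- A nonzero `u ∈ V` would give a pure input state whose output `|ψ⟩⟨ψ|` still has its range in
`V`. This is the obstruction used to show that sufficiency is necessary. -/
theorem Prepares.apply_eq_zero_of_invariant {L : List (Op (Cfg d) →ₗ[ℂ] Op (Cfg d))}
    (hψ : ‖ψ‖ = 1) (h : Prepares L (ketbra ψ)) {V : Submodule ℂ (Hilb (Cfg d))}
    (hV : ∀ F ∈ L, ∀ M, (∀ v, act M v ∈ V) → ∀ v, act (F M) v ∈ V) (hψV : ψ ∉ V) {u : Hilb (Cfg d)}
    (hu : u ∈ V) : u = 0 := by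
  by_contra hu0
  have hnorm : ‖u‖ ≠ 0 := norm_ne_zero_iff.2 hu0
  have hw1 : ‖((‖u‖ : ℂ)⁻¹) • u‖ = 1 := by
    rw [norm_smul, norm_inv, Complex.norm_real, norm_norm, inv_mul_cancel₀ hnorm]
  have h1 := applyMaps_mem hV (M := ketbra (((‖u‖ : ℂ)⁻¹) • u)) (fun v => by
    rw [act_ketbra]
    exact V.smul_mem _ (V.smul_mem _ hu)) ψ
  rw [h _ (isDensity_ketbra hw1), act_ketbra, inner_self_eq_norm_sq_to_K, hψ] at h1
  exact hψV (by simpa using h1)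

theorem IsResettingFamily.isSufficient (hE : IsResettingFamily nbhd ψ τ E) (hψ : ‖ψ‖ = 1)
    {L : List (Fin K)} (hL : Prepares (L.map E) (ketbra ψ)) :
    IsSufficient nbhd ψ {j | j ∈ L} := by
  have hψ0 : ψ ≠ 0 := fun h => by simp [h] at hψ
  constructor
  · intro i
    by_contra! h
    obtain ⟨htop, hi⟩ := h
    obtain ⟨x, hx, hx0⟩ := Submodule.exists_mem_ne_zero_of_ne_bot
      fun h => htop (Submodule.orthogonal_eq_bot_iff.1 h)
    obtain ⟨z, hz⟩ : ∃ z, ψ z ≠ 0 := by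
      by_contra! h
      exact hψ0 (PiLp.ext h)
    -- If no map touches site `i`, the kernel of its site projector is invariant; it contains a
    -- product vector with `x` at site `i`, and not `ψ`.
    have hv : prodVec (Function.update (fun k => EuclideanSpace.single (z k) (1 : ℂ)) i x) = 0 := by
      refine hL.apply_eq_zero_of_invariant hψ
        (V := LinearMap.ker (act (siteProj d ψ i))) (fun F hF => ?_) ?_ ?_
      · obtain ⟨j, hj, rfl⟩ := List.mem_map.1 hF
        exact fun M hM => (hE.isNeighborhoodMap j).apply_mem_ker_siteProj (hi j hj) hM
      · rw [LinearMap.mem_ker, mem_localSupport_iff.1 (self_mem_localSupport d ψ) i]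
        exact hψ0
      · rw [LinearMap.mem_ker, siteProj, act_ampliate_single_prodVec, Function.update_self,
          act_proj_eq_zero_iff.2 hx, ← norm_eq_zero, norm_prodVec]
        exact Finset.prod_eq_zero (Finset.mem_univ i) (by simp)
    rw [← norm_eq_zero, norm_prodVec] at hv
    obtain ⟨k, -, hk⟩ := Finset.prod_eq_zero_iff.1 hv
    by_cases hki : k = i
    · subst hki
      rw [Function.update_self] at hk
      exact hx0 (norm_eq_zero.1 hk)
    · simp [Function.update_of_ne hki] at hk
  · intro j hj u hu
    -- If `j` does not occur in the list, the part of the local support killed by `Π_j` is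
    -- invariant, and `ψ` is not in it.
    have hw : u - act (schmidtProj d ψ (nbhd j)) u = 0 := by
      refine hL.apply_eq_zero_of_invariant hψ
        (V := localSupport d ψ ⊓ LinearMap.ker (act (schmidtProj d ψ (nbhd j))))
        (fun F hF => ?_) ?_ ?_
      · obtain ⟨k, hk, rfl⟩ := List.mem_map.1 hF
        have hkj : k ≠ j := fun h => hj (h ▸ hk)
        exact hE.invariant k _ inf_le_left
          fun A hA u hu => act_mem_localSupport_inf_ker hkj hA hu
      · intro h
        have h2 := LinearMap.mem_ker.1 h.2
        rw [act_schmidtProj_self] at h2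
        exact hψ0 h2
      · refine ⟨Submodule.sub_mem _ hu (act_schmidtProj_mem_localSupport _ hu), ?_⟩
        rw [SetLike.mem_coe, LinearMap.mem_ker, map_sub, ← act_mul, schmidtProj_mul_self, sub_self]
    exact (sub_eq_zero.1 hw).symm

theorem isRFTS_of_complete (hψ : ‖ψ‖ = 1) (hQLS : IsQLS d nbhd (ketbra ψ))
    (hcomm : IsCommutingFamily (restrictedAlgebra d nbhd ψ))
    (hcompl : IsCompleteFamily (restrictedAlgebra d nbhd ψ)) : IsRFTS d nbhd (ketbra ψ) := by
  classical
  obtain ⟨τ, hτ, hτ1, E, hE⟩ := exists_isResettingFamily hψ hQLS hcomm hcompl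
  -- A sufficient list of least length gives the exact `T`: a shorter initial segment that prepared
  -- `ψ` would be sufficient, and a permutation leaves the set of indices unchanged.
  have hex : ∃ n, ∃ L : List (Fin K), L.length = n ∧ IsSufficient nbhd ψ {j | j ∈ L} := by
    refine ⟨_, List.finRange K, rfl, ?_⟩
    convert isSufficient_univ hψ hQLS
    ext j
    simp
  obtain ⟨L, hlen, hL⟩ := Nat.find_spec hex
  have hmin : ∀ L' : List (Fin K), L'.length < L.length → ¬ IsSufficient nbhd ψ {j | j ∈ L'} :=
    fun L' hlt hL' => Nat.find_min hex (hlen ▸ hlt) ⟨L', rfl, hL'⟩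
  have hofFn : List.ofFn (fun t => E (L.get t)) = L.map E := by
    conv_rhs => rw [← List.ofFn_get L, List.map_ofFn]
    rfl
  refine ⟨L.length, fun t => E (L.get t), ⟨fun t => ⟨_, hE.isNeighborhoodMap _⟩,
    fun t => hE.map_ketbra _, ?_, fun S hS hprep => ?_⟩, fun π => ?_⟩
  · rw [hofFn]
    exact hE.prepares hψ hQLS hτ hτ1 hL
  · rw [hofFn, ← List.map_take] at hprep
    exact hmin _ (by simpa using hS) (hE.isSufficient hψ hprep)
  · have hπ : List.ofFn (fun t => E (L.get (π t))) = (List.ofFn fun t => L.get (π t)).map E := by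
      rw [List.map_ofFn]
      rfl
    rw [hπ]
    refine hE.prepares hψ hQLS hτ hτ1 ?_
    convert hL using 2
    ext j
    rw [List.mem_ofFn, List.mem_iff_get]
    exact ⟨fun ⟨t, ht⟩ => ⟨π t, ht⟩, fun ⟨t, ht⟩ => ⟨π.symm t, by simpa using ht⟩⟩

end Stabilization

end QuasiLocal

end

theorem mainTheorem9 {N K : ℕ} (d : Fin N → ℕ) (nbhd : Fin K → Finset (Fin N))
    (ψ : Hilb (Cfg d)) (hψ : ‖ψ‖ = 1)
    (hQLS : IsQLS d nbhd (ketbra ψ))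
    (hcomm : IsCommutingFamily (restrictedAlgebra d nbhd ψ))
    (hcompl : IsCompleteFamily (restrictedAlgebra d nbhd ψ)) :
    (∃ (m : Fin K → ℕ) (W : localSupport d ψ ≃ₗᵢ[ℂ] Hilb (Cfg m)),
      IsInducedFactorization d nbhd ψ m W) ∧
    (∀ (m : Fin K → ℕ) (W : localSupport d ψ ≃ₗᵢ[ℂ] Hilb (Cfg m)),
      IsInducedFactorization d nbhd ψ m W →
        ∃ φ : ∀ j, Hilb (Fin (m j)), (∀ j, ‖φ j‖ = 1) ∧
          ((W.symm (prodVec φ) : localSupport d ψ) : Hilb (Cfg d)) = ψ) ∧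
    IsRFTS d nbhd (ketbra ψ) := by
  refine ⟨exists_isInducedFactorization hψ hQLS hcomm hcompl, fun m W hW => ?_,
    isRFTS_of_complete hψ hQLS hcomm hcompl⟩
  obtain ⟨φ, hφ, hφψ⟩ := hW.exists_prodVec hψ hQLS hcomm hcompl
  refine ⟨φ, hφ, ?_⟩
  rw [hφψ, W.symm_apply_apply]
  rfl
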